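/- Let $\ell>0$ and $\mu\in\mathbb R$. Let $V=L^2(0,\ell)$ (real-valued), $V_{1/2}=\{f\in H^1(0,\ell): f(0)=0\}$ with norm $\|f\|_{1/2}=\|f_x\|_{L^2}$, $V_{-1/2}=(V_{1/2})'$ with pivot space $V$, let $\delta_\ell\in V_{-1/2}$ be the Dirac mass $\langle\delta_\ell,f\rangle=f(\ell)$, and let $\mathcal V=V_{1/2}\times V$ with its Hilbert norm. Consider the system $$y_{tt}-y_{xx}=0\ \text{ in }(0,\ell)\times(0,\infty),\qquad y(0,t)=0\ \ (t>0),$$ $$y_x(\ell,t)=0\ \ (0<t<2\ell),\qquad y_x(\ell,t)=\mu\,y_t(\ell,t-2\ell)\ \ (t>2\ell),\qquad (y,y_t)(0)=(y_0,y_1).$$ A finite-energy solution is a function $y$ with $(y,y_t)\in C([0,\infty);\mathcal V)$, where $y_t$ is the derivative of $y$ as a $V$-valued function, with $(y,y_t)(0)=(y_0,y_1)$, such that the trace $t\mapsto y(\ell,t)$ has a weak derivative $y_t(\ell,\cdot)\in L^2(0,T)$ for every $T>0$ and, for all $\varphi\in V_{1/2}$ and $t\ge 0$, $$\langle y_t(t),\varphi\rangle_V=\langle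 y_1,\varphi\rangle_V+\int_0^t\big(-\langle y_x(s),\varphi_x\rangle_V+g(s)\varphi(\ell)\big)\,ds,$$ where $g(s)=0$ for $s<2\ell$ and $g(s)=\mu\,y_t(\ell,s-2\ell)$ for $s>2\ell$. Let $Ay=-y_{xx}$ with domain $V_1=\{f\in H^2(0,\ell): f(0)=0,\ f_x(\ell)=0\}$ and $\mathcal A(y,z)=(z,-Ay)$ with domain $V_1\times V_{1/2}$. Then $\mathcal A$ generates a strongly continuous group of isometries $(\mathcal S(t))_{t\in\mathbb R}$ on $\mathcal V$, which extends to a strongly continuous group $(\mathcal S_{-1}(t))_{t\in\mathbb R}$ on $V\times V_{-1/2}$, and the system is well-posed on $\mathcal V$: 1. (Existence and uniqueness.) For every $(y_0,y_1)\in\mathcal V$ there is exactly one finite-energy solution $y$. 2. (Continuous dependence.) For every $T>0$ there is a constant $C$, depending only on $T,\ell,\mu$, such that any two solutions $y,\tilde y$ satisfy $\|(y,y_t)(t)-(\tilde y,\tilde y_t)(t)\|_{\mathcal V}\le C\,\|(y_0,y_1)-(\tilde y_0,\tilde y_1)\|_{\mathcal V}$ for all $t\in[0,T]$. 3. (Explicit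 form.) Let $y^j$ be the restriction of the solution $y$ to $[2j\ell,2(j+1)\ell]$, $j=0,1,2,\dots$. Then $$\begin{pmatrix}y^0(t)\\ y^0_t(t)\end{pmatrix}=\mathcal S(t)\begin{pmatrix}y_0\\ y_1\end{pmatrix},\qquad t\in[0,2\ell],$$ and for all $j\ge 1$ and $t\in[2j\ell,2(j+1)\ell]$ $$\begin{pmatrix}y^j(t)\\ y^j_t(t)\end{pmatrix}=\mathcal S(t-2j\ell)\begin{pmatrix}y^{j-1}(2j\ell)\\ y^{j-1}_t(2j\ell)\end{pmatrix}+\int_{2j\ell}^t\mathcal S_{-1}(t-s)\begin{pmatrix}0\\ \mu\,y^{j-1}_t(\ell,s-2\ell)\,\delta_\ell\end{pmatrix}ds,$$ where the integral is a (convergent) Bochner integral in $V\times V_{-1/2}$. 4. (Regularity.) $(y^j,y^j_t)\in C([2j\ell,2(j+1)\ell];\mathcal V)$ for all $j\ge 0$. -/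

import Mathlib

open Set MeasureTheory
open scoped ContDiff

noncomputable section

namespace SwitchingDelayWave

/-! ### Sobolev functions on `(0, ℓ)` -/

/-- The real Hilbert space `V = L²(0, ℓ)`. -/
abbrev V (ℓ : ℝ) : Type := Lp ℝ 2 (volume.restrict (Ioo 0 ℓ))

/-- `g` is the weak (distributional) derivative of `f` on `(0, ℓ)`. -/
def HasWeakDeriv {ℓ : ℝ} (f g : V ℓ) : Prop :=
  ∀ φ : ℝ → ℝ, ContDiff ℝ ∞ φ → HasCompactSupport φ → tsupport φ ⊆ Ioo 0 ℓ →
    ∫ x in Ioo 0 ℓ, f x * deriv φ x = -∫ x in Ioo 0 ℓ, g x * φ x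

/-- `F` is a representative of the class `f` that is continuous on `[0, ℓ]`. -/
def IsContRep {ℓ : ℝ} (f : V ℓ) (F : ℝ → ℝ) : Prop :=
  ContinuousOn F (Icc 0 ℓ) ∧ f =ᵐ[volume.restrict (Ioo 0 ℓ)] F

/-- The value at the point `a` of the continuous representative of `f` is `c`. -/
def HasTrace {ℓ : ℝ} (f : V ℓ) (a c : ℝ) : Prop :=
  ∃ F : ℝ → ℝ, IsContRep f F ∧ F a = c

theorem integrableOn_V {ℓ : ℝ} (f : V ℓ) : IntegrableOn f (Ioo 0 ℓ) :=
  (Lp.memLp f).integrable (by norm_num)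

theorem V_eq_zero {ℓ : ℝ} (hℓ : ¬ 0 < ℓ) (f : V ℓ) : f = 0 := by
  have h0 : volume.restrict (Ioo 0 ℓ) = 0 := by
    rw [Ioo_eq_empty hℓ, Measure.restrict_empty]
  refine Lp.ext ?_
  have hb : ae (volume.restrict (Ioo 0 ℓ)) = ⊥ := by rw [h0, ae_zero]
  rw [Filter.EventuallyEq, hb]
  exact Filter.eventually_bot

theorem integrable_mul_test {ℓ : ℝ} (f : V ℓ) {φ : ℝ → ℝ} (hφ : Continuous φ)
    (hc : HasCompactSupport φ) : IntegrableOn (fun x => f x * φ x) (Ioo 0 ℓ) := by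
  obtain ⟨C, hC⟩ := hφ.bounded_above_of_compact_support hc
  exact (integrableOn_V f).mul_bdd hφ.aestronglyMeasurable
    (Filter.Eventually.of_forall hC)

theorem HasWeakDeriv.add {ℓ : ℝ} {f g f' g' : V ℓ} (h : HasWeakDeriv f g)
    (h' : HasWeakDeriv f' g') : HasWeakDeriv (f + f') (g + g') := by
  intro φ hφ hc hs
  have hd : Continuous (deriv φ) := (contDiff_infty_iff_deriv.1 hφ).2.continuous
  have e1 : ∫ x in Ioo 0 ℓ, (f + f' : V ℓ) x * deriv φ x =
      (∫ x in Ioo 0 ℓ, f x * deriv φ x) + ∫ x in Ioo 0 ℓ, f' x * deriv φ x := by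
    rw [← integral_add (integrable_mul_test f hd hc.deriv) (integrable_mul_test f' hd hc.deriv)]
    refine integral_congr_ae ?_
    filter_upwards [Lp.coeFn_add f f'] with x hx
    rw [hx, Pi.add_apply]; ring
  have e2 : ∫ x in Ioo 0 ℓ, (g + g' : V ℓ) x * φ x =
      (∫ x in Ioo 0 ℓ, g x * φ x) + ∫ x in Ioo 0 ℓ, g' x * φ x := by
    rw [← integral_add (integrable_mul_test g hφ.continuous hc)
      (integrable_mul_test g' hφ.continuous hc)]
    refine integral_congr_ae ?_
    filter_upwards [Lp.coeFn_add g g'] with x hx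
    rw [hx, Pi.add_apply]; ring
  rw [e1, e2, h φ hφ hc hs, h' φ hφ hc hs]; ring

theorem HasWeakDeriv.smul {ℓ : ℝ} {f g : V ℓ} (h : HasWeakDeriv f g) (c : ℝ) :
    HasWeakDeriv (c • f) (c • g) := by
  intro φ hφ hc hs
  have e1 : ∫ x in Ioo 0 ℓ, (c • f : V ℓ) x * deriv φ x =
      c * ∫ x in Ioo 0 ℓ, f x * deriv φ x := by
    rw [← integral_const_mul]
    refine integral_congr_ae ?_
    filter_upwards [Lp.coeFn_smul c f] with x hx
    rw [hx, Pi.smul_apply, smul_eq_mul]; ring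
  have e2 : ∫ x in Ioo 0 ℓ, (c • g : V ℓ) x * φ x = c * ∫ x in Ioo 0 ℓ, g x * φ x := by
    rw [← integral_const_mul]
    refine integral_congr_ae ?_
    filter_upwards [Lp.coeFn_smul c g] with x hx
    rw [hx, Pi.smul_apply, smul_eq_mul]; ring
  rw [e1, e2, h φ hφ hc hs]; ring

theorem HasWeakDeriv.unique {ℓ : ℝ} {f g g' : V ℓ} (h : HasWeakDeriv f g)
    (h' : HasWeakDeriv f g') : g = g' := by
  have key := isOpen_Ioo.ae_eq_zero_of_integral_contDiff_smul_eq_zero (μ := volume)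
    (U := Ioo 0 ℓ) (f := fun x => g x - g' x)
    (((integrableOn_V g).sub (integrableOn_V g')).locallyIntegrableOn) ?_
  · apply Lp.ext
    rw [Filter.EventuallyEq, ae_restrict_iff' measurableSet_Ioo]
    filter_upwards [key] with x hx hxm
    exact sub_eq_zero.1 (hx hxm)
  · intro φ hφ hc hs
    have e : ∫ x, φ x • (g x - g' x) = ∫ x in Ioo 0 ℓ, φ x • (g x - g' x) := by
      refine (setIntegral_eq_integral_of_forall_compl_eq_zero fun x hx => ?_).symm
      rw [image_eq_zero_of_notMem_tsupport (fun hx' => hx (hs hx')), zero_smul]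
    have e2 : ∫ x in Ioo 0 ℓ, φ x • (g x - g' x) =
        (∫ x in Ioo 0 ℓ, g x * φ x) - ∫ x in Ioo 0 ℓ, g' x * φ x := by
      rw [← integral_sub (integrable_mul_test g hφ.continuous hc)
        (integrable_mul_test g' hφ.continuous hc)]
      refine integral_congr_ae (Filter.Eventually.of_forall fun x => ?_)
      simp only [smul_eq_mul]; ring
    have := h φ hφ hc hs
    have := h' φ hφ hc hs
    rw [e, e2]; linarith

/-- Fundamental theorem of calculus for Sobolev functions: the continuous representative is the
primitive of the weak derivative. -/
theorem IsContRep.eq_integral {ℓ : ℝ} (hℓ : 0 < ℓ) {f g : V ℓ} {F : ℝ → ℝ} (hF : IsContRep f F)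
    (h : HasWeakDeriv f g) {x : ℝ} (hx : x ∈ Icc 0 ℓ) : F x = F 0 + ∫ s in (0 : ℝ)..x, g s := by
  have hgI : IntervalIntegrable g volume 0 ℓ :=
    (intervalIntegrable_iff_integrableOn_Ioo_of_le hℓ.le).2 (integrableOn_V g)
  set G : ℝ → ℝ := fun x => ∫ s in (0 : ℝ)..x, g s with hG
  have hGac : AbsolutelyContinuousOnInterval G 0 ℓ :=
    hgI.absolutelyContinuousOnInterval_intervalIntegral left_mem_uIcc
  have hGc : ContinuousOn G (Icc 0 ℓ) := by simpa [uIcc_of_le hℓ.le] using hGac.continuousOn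
  set H : ℝ → ℝ := fun x => F x - G x with hH
  have hHc : ContinuousOn H (Icc 0 ℓ) := hF.1.sub hGc
  have hHint : ∀ η : ℝ → ℝ, Continuous η → IntegrableOn (fun x => H x * η x) (Ioo 0 ℓ) :=
    fun η hη => ((hHc.mul hη.continuousOn).integrableOn_Icc).mono_set Ioo_subset_Icc_self
  -- `H` is orthogonal to the derivatives of test functions
  have horth : ∀ φ : ℝ → ℝ, ContDiff ℝ ∞ φ → HasCompactSupport φ → tsupport φ ⊆ Ioo 0 ℓ →
      ∫ x in Ioo 0 ℓ, H x * deriv φ x = 0 := by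
    intro φ hφ hc hs
    have hd : Continuous (deriv φ) := (contDiff_infty_iff_deriv.1 hφ).2.continuous
    have hFi : IntegrableOn (fun x => F x * deriv φ x) (Ioo 0 ℓ) :=
      ((hF.1.mul hd.continuousOn).integrableOn_Icc).mono_set Ioo_subset_Icc_self
    have hGi : IntegrableOn (fun x => G x * deriv φ x) (Ioo 0 ℓ) :=
      ((hGc.mul hd.continuousOn).integrableOn_Icc).mono_set Ioo_subset_Icc_self
    have h1 : ∫ x in Ioo 0 ℓ, F x * deriv φ x = -∫ x in Ioo 0 ℓ, g x * φ x := by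
      rw [← h φ hφ hc hs]
      refine integral_congr_ae ?_
      filter_upwards [hF.2] with x hx
      rw [hx]
    have hφac : AbsolutelyContinuousOnInterval φ 0 ℓ :=
      (hφ.of_le (by exact_mod_cast le_top)).contDiffOn.absolutelyContinuousOnInterval
    have hφ0 : φ 0 = 0 := image_eq_zero_of_notMem_tsupport fun h => lt_irrefl _ (hs h).1
    have hφℓ : φ ℓ = 0 := image_eq_zero_of_notMem_tsupport fun h => lt_irrefl _ (hs h).2
    have h2 : ∫ x in Ioo 0 ℓ, G x * deriv φ x = -∫ x in Ioo 0 ℓ, g x * φ x := by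
      rw [← integral_Ioc_eq_integral_Ioo, ← integral_Ioc_eq_integral_Ioo,
        ← intervalIntegral.integral_of_le hℓ.le, ← intervalIntegral.integral_of_le hℓ.le,
        hGac.integral_mul_deriv_eq_deriv_mul hφac, hφ0, hφℓ]
      have : ∫ x in (0 : ℝ)..ℓ, deriv G x * φ x = ∫ x in (0 : ℝ)..ℓ, g x * φ x := by
        refine intervalIntegral.integral_congr_ae ?_
        filter_upwards [hgI.ae_hasDerivAt_integral] with x hx hxm
        rw [(hx (uIoc_subset_uIcc hxm) 0 left_mem_uIcc).deriv]
      rw [this]; ring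
    simp only [hH, sub_mul]
    rw [integral_sub hFi hGi, h1, h2, sub_self]
  -- hence to all test functions of mean zero
  have horth0 : ∀ η : ℝ → ℝ, ContDiff ℝ ∞ η → HasCompactSupport η → tsupport η ⊆ Ioo 0 ℓ →
      ∫ x in Ioo 0 ℓ, η x = 0 → ∫ x in Ioo 0 ℓ, H x * η x = 0 := by
    intro η hη hc hs h0
    set Φ : ℝ → ℝ := fun x => ∫ s in (0 : ℝ)..x, η s with hΦ
    have hΦd : ∀ x, HasDerivAt Φ (η x) x := fun x =>
      intervalIntegral.integral_hasDerivAt_right (hη.continuous.intervalIntegrable _ _)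
        hη.continuous.stronglyMeasurable.stronglyMeasurableAtFilter hη.continuous.continuousAt
    have hΦ' : deriv Φ = η := funext fun x => (hΦd x).deriv
    have hΦs : ContDiff ℝ ∞ Φ :=
      contDiff_infty_iff_deriv.2 ⟨fun x => (hΦd x).differentiableAt, by rwa [hΦ']⟩
    obtain ⟨a, b, ha, hb, hab⟩ : ∃ a b, 0 < a ∧ b < ℓ ∧ tsupport η ⊆ Icc a b := by
      rcases (tsupport η).eq_empty_or_nonempty with he | hne
      · exact ⟨ℓ, 0, hℓ, hℓ, by simp [he]⟩
      · have hK : IsCompact (tsupport η) := hc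
        exact ⟨sInf (tsupport η), sSup (tsupport η), (hs (hK.sInf_mem hne)).1,
          (hs (hK.sSup_mem hne)).2, fun x hx =>
            ⟨csInf_le hK.bddBelow hx, le_csSup hK.bddAbove hx⟩⟩
    have hη0 : ∀ s, s ∉ Icc a b → η s = 0 := fun s hs' =>
      image_eq_zero_of_notMem_tsupport fun h => hs' (hab h)
    have hΦ0 : ∀ x, x ∉ Icc a b → Φ x = 0 := by
      intro x hx
      rcases lt_or_ge x a with hxa | hxa
      · refine intervalIntegral.integral_zero_ae (Filter.Eventually.of_forall fun s hs' => ?_)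
        refine hη0 s fun h => ?_
        have := uIoc_subset_uIcc hs'
        rw [mem_uIcc] at this
        rcases this with h' | h' <;> linarith [h.1, h'.2]
      · have hxb : b < x := by
          by_contra hcon
          exact hx ⟨hxa, not_lt.1 hcon⟩
        have e1 : (∫ s in (0 : ℝ)..ℓ, η s) = 0 := by
          rw [intervalIntegral.integral_of_le hℓ.le, integral_Ioc_eq_integral_Ioo, h0]
        have e2 : (∫ s in ℓ..x, η s) = 0 := by
          refine intervalIntegral.integral_zero_ae (Filter.Eventually.of_forall fun s hs' => ?_)
          refine hη0 s fun h => ?_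
          have hs'' : min ℓ x < s := hs'.1
          have : b < min ℓ x := lt_min hb hxb
          linarith [h.2]
        rw [hΦ]
        simp only
        rw [← intervalIntegral.integral_add_adjacent_intervals
          (hη.continuous.intervalIntegrable 0 ℓ) (hη.continuous.intervalIntegrable ℓ x), e1, e2,
          add_zero]
    have hts : tsupport Φ ⊆ Icc a b :=
      closure_minimal (fun x hx => by
        by_contra hcon
        exact hx (hΦ0 x hcon)) isClosed_Icc
    have := horth Φ hΦs (HasCompactSupport.of_support_subset_isCompact isCompact_Icc
      ((subset_tsupport Φ).trans hts))
      (hts.trans fun x hx => ⟨ha.trans_le hx.1, hx.2.trans_lt hb⟩)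
    rwa [hΦ'] at this
  -- a test function of mean one
  obtain ⟨ψ, hψs, hψc, hψt, hψ1⟩ : ∃ ψ : ℝ → ℝ, ContDiff ℝ ∞ ψ ∧ HasCompactSupport ψ ∧
      tsupport ψ ⊆ Ioo 0 ℓ ∧ ∫ x in Ioo 0 ℓ, ψ x = 1 := by
    let B : ContDiffBump (ℓ / 2) := ⟨ℓ / 8, ℓ / 4, by positivity, by linarith⟩
    have hsub : tsupport (B.normed volume) ⊆ Ioo 0 ℓ := by
      rw [B.tsupport_normed_eq, Real.closedBall_eq_Icc]
      intro x hx
      have h1 : ℓ / 2 - ℓ / 4 ≤ x := hx.1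
      have h2 : x ≤ ℓ / 2 + ℓ / 4 := hx.2
      exact ⟨by linarith, by linarith⟩
    refine ⟨B.normed volume, B.contDiff_normed, B.hasCompactSupport_normed, hsub, ?_⟩
    rw [setIntegral_eq_integral_of_forall_compl_eq_zero
      fun x hx => image_eq_zero_of_notMem_tsupport fun hx' => hx (hsub hx')]
    exact B.integral_normed
  set c : ℝ := ∫ x in Ioo 0 ℓ, H x * ψ x with hc
  have hae := isOpen_Ioo.ae_eq_zero_of_integral_contDiff_smul_eq_zero (μ := volume)
    (U := Ioo 0 ℓ) (f := fun x => H x - c)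
    (((hHc.sub continuousOn_const).mono Ioo_subset_Icc_self).locallyIntegrableOn
      measurableSet_Ioo) ?_
  · have hEq : EqOn H (fun _ => c) (Icc 0 ℓ) := by
      refine Measure.eqOn_Icc_of_ae_eq volume hℓ.ne ?_ hHc continuousOn_const
      rw [Filter.EventuallyEq, ae_restrict_iff' measurableSet_Icc]
      have hne : ∀ y : ℝ, ∀ᵐ x : ℝ, x ≠ y := fun y => by
        rw [ae_iff]; simp
      filter_upwards [hae, hne 0, hne ℓ] with x hx h0 h1 hxm
      exact sub_eq_zero.1 (hx ⟨lt_of_le_of_ne hxm.1 (Ne.symm h0), lt_of_le_of_ne hxm.2 h1⟩)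
    have e0 : H 0 = c := hEq (left_mem_Icc.2 hℓ.le)
    have ex : H x = c := hEq hx
    have hG0 : G 0 = 0 := by simp [hG]
    have : F x - G x = F 0 - G 0 := ex.trans e0.symm
    rw [hG0] at this
    change F x = F 0 + G x
    linarith
  · intro η hη hηc hηt
    set m : ℝ := ∫ x in Ioo 0 ℓ, η x with hm
    have hηi : IntegrableOn η (Ioo 0 ℓ) := (hη.continuous.integrable_of_hasCompactSupport hηc).integrableOn
    have hψi : IntegrableOn ψ (Ioo 0 ℓ) := (hψs.continuous.integrable_of_hasCompactSupport hψc).integrableOn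
    have hmean : ∫ x in Ioo 0 ℓ, (η x + (-m) * ψ x) = 0 := by
      rw [integral_add hηi (hψi.const_mul _), integral_const_mul, hψ1]; ring
    have hsupp : tsupport (fun x => η x + (-m) * ψ x) ⊆ tsupport η ∪ tsupport ψ := by
      refine closure_minimal (fun x hx => ?_) ((isClosed_tsupport _).union (isClosed_tsupport _))
      by_contra hcon
      rw [mem_union, not_or] at hcon
      refine hx ?_
      simp [image_eq_zero_of_notMem_tsupport hcon.1, image_eq_zero_of_notMem_tsupport hcon.2]
    have hz := horth0 (fun x => η x + (-m) * ψ x) (hη.add (contDiff_const.mul hψs))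
      (IsCompact.of_isClosed_subset (IsCompact.union hηc hψc) (isClosed_tsupport _) hsupp)
      (hsupp.trans (union_subset hηt hψt)) hmean
    have e : ∫ x, η x • (H x - c) = ∫ x in Ioo 0 ℓ, η x • (H x - c) := by
      refine (setIntegral_eq_integral_of_forall_compl_eq_zero fun x hx => ?_).symm
      rw [image_eq_zero_of_notMem_tsupport (fun hx' => hx (hηt hx')), zero_smul]
    have e1 : ∫ x in Ioo 0 ℓ, H x * (η x + (-m) * ψ x) =
        (∫ x in Ioo 0 ℓ, H x * η x) + (-m) * c := by
      rw [hc, ← integral_const_mul, ← integral_add (hHint η hη.continuous)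
        ((hHint ψ hψs.continuous).const_mul _)]
      refine integral_congr_ae (Filter.Eventually.of_forall fun x => ?_)
      simp only; ring
    have e2 : ∫ x in Ioo 0 ℓ, η x • (H x - c) = (∫ x in Ioo 0 ℓ, H x * η x) + (-c) * m := by
      rw [hm, ← integral_const_mul, ← integral_add (hHint η hη.continuous)
        (hηi.const_mul _)]
      refine integral_congr_ae (Filter.Eventually.of_forall fun x => ?_)
      simp only [smul_eq_mul]; ring
    rw [e, e2]
    rw [e1] at hz
    linarith

/-- A bound for primitives of square integrable functions. -/
theorem abs_integral_le {ℓ : ℝ} (hℓ : 0 < ℓ) (g : V ℓ) {x : ℝ} (hx : x ∈ Icc 0 ℓ) :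
    |∫ s in (0 : ℝ)..x, g s| ≤ √ℓ * ‖g‖ := by
  have hfin : volume.restrict (Ioo 0 ℓ) (Ioc 0 x) ≠ ⊤ := measure_ne_top _ _
  have e : ∫ s in (0 : ℝ)..x, g s =
      inner ℝ (indicatorConstLp 2 measurableSet_Ioc hfin (1 : ℝ)) g := by
    rw [L2.inner_indicatorConstLp_one, intervalIntegral.integral_of_le hx.1,
      Measure.restrict_restrict measurableSet_Ioc]
    rw [integral_Ioc_eq_integral_Ioo]
    symm
    refine setIntegral_congr_set ?_
    have : (Ioc 0 x ∩ Ioo 0 ℓ : Set ℝ) =ᵐ[volume] (Ioc 0 x ∩ Ioc 0 ℓ : Set ℝ) :=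
      (Filter.EventuallyEq.refl _ _).inter Ioo_ae_eq_Ioc
    refine this.trans ?_
    rw [Ioc_inter_Ioc, max_self, min_eq_left hx.2]
    exact Ioo_ae_eq_Ioc.symm
  have hn : ‖indicatorConstLp 2 measurableSet_Ioc hfin (1 : ℝ)‖ ≤ √ℓ := by
    rw [norm_indicatorConstLp (by norm_num) (by norm_num), norm_one, one_mul,
      Real.sqrt_eq_rpow]
    have h1 : (volume.restrict (Ioo 0 ℓ)).real (Ioc 0 x) ≤ ℓ := by
      have := measureReal_mono (μ := volume.restrict (Ioo 0 ℓ)) (subset_univ (Ioc 0 x))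
      simpa [hℓ.le] using this
    simpa using Real.rpow_le_rpow measureReal_nonneg h1 (by norm_num : (0 : ℝ) ≤ 1 / 2)
  rw [e]
  exact (abs_real_inner_le_norm _ _).trans (by gcongr)

/-! ### The energy space -/

/-- `V_{1/2} = {f ∈ H¹(0, ℓ) : f(0) = 0}`, as a subspace of `L²(0, ℓ)`. -/
def vHalfSubmodule (ℓ : ℝ) : Submodule ℝ (V ℓ) where
  carrier := {f | (∃ g, HasWeakDeriv f g) ∧ HasTrace f 0 0}
  zero_mem' := by
    refine ⟨⟨0, fun φ _ _ _ => ?_⟩, 0, ⟨continuousOn_const, Lp.coeFn_zero _ _ _⟩, rfl⟩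
    have h0 : ∀ η : ℝ → ℝ, ∫ x in Ioo 0 ℓ, (0 : V ℓ) x * η x = 0 := fun η => by
      refine (integral_congr_ae (g := fun _ => (0 : ℝ)) ?_).trans (by simp)
      filter_upwards [Lp.coeFn_zero ℝ 2 (volume.restrict (Ioo 0 ℓ))] with x hx
      rw [hx]; simp
    rw [h0, h0, neg_zero]
  add_mem' := by
    rintro f f' ⟨⟨g, hg⟩, F, hF, hF0⟩ ⟨⟨g', hg'⟩, F', hF', hF0'⟩
    exact ⟨⟨g + g', hg.add hg'⟩, F + F', ⟨hF.1.add hF'.1,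
      (Lp.coeFn_add f f').trans (hF.2.add hF'.2)⟩, by simp [hF0, hF0']⟩
  smul_mem' := by
    rintro c f ⟨⟨g, hg⟩, F, hF, hF0⟩
    exact ⟨⟨c • g, hg.smul c⟩, c • F, ⟨hF.1.const_smul c,
      (Lp.coeFn_smul c f).trans (hF.2.const_smul c)⟩, by simp [hF0]⟩

theorem exists_weakDeriv {ℓ : ℝ} (f : vHalfSubmodule ℓ) : ∃ g, HasWeakDeriv f.1 g := f.2.1

/-- The weak derivative `f ↦ f_x` on the subspace `V_{1/2}` of `V`. -/
def dxₗ (ℓ : ℝ) : vHalfSubmodule ℓ →ₗ[ℝ] V ℓ where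
  toFun f := (exists_weakDeriv f).choose
  map_add' f f' := (exists_weakDeriv (f + f')).choose_spec.unique
    ((exists_weakDeriv f).choose_spec.add (exists_weakDeriv f').choose_spec)
  map_smul' c f := (exists_weakDeriv (c • f)).choose_spec.unique
    ((exists_weakDeriv f).choose_spec.smul c)

theorem norm_le_norm_dxₗ {ℓ : ℝ} (hℓ : 0 < ℓ) (f : vHalfSubmodule ℓ) :
    ‖f.1‖ ≤ ℓ * ‖dxₗ ℓ f‖ := by
  obtain ⟨F, hF, hF0⟩ := f.2.2
  have h := Lp.norm_le_of_ae_bound (f := f.1) (C := √ℓ * ‖dxₗ ℓ f‖) (by positivity) ?_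
  · refine h.trans (le_of_eq ?_)
    have h1 : (volume.restrict (Ioo 0 ℓ)).real univ = ℓ := by simp [hℓ.le]
    have h2 : ((2 : ENNReal).toReal)⁻¹ = 1 / 2 := by simp
    have h3 : ((measureUnivNNReal (volume.restrict (Ioo 0 ℓ)) : NNReal) : ℝ) = ℓ := h1
    rw [h2, ← Real.sqrt_eq_rpow, h3, ← mul_assoc, Real.mul_self_sqrt hℓ.le]
  · filter_upwards [hF.2, ae_restrict_mem measurableSet_Ioo] with x hx hxm
    have hxm' := Ioo_subset_Icc_self hxm
    rw [hx, hF.eq_integral hℓ (exists_weakDeriv f).choose_spec hxm', hF0, zero_add]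
    exact abs_integral_le hℓ _ hxm'

theorem dxₗ_injective (ℓ : ℝ) : Function.Injective (dxₗ ℓ) := by
  refine (injective_iff_map_eq_zero (dxₗ ℓ)).2 fun f hf => Subtype.ext ?_
  by_cases hℓ : 0 < ℓ
  · have := norm_le_norm_dxₗ hℓ f
    rw [hf, norm_zero, mul_zero] at this
    exact norm_le_zero_iff.1 this
  · exact V_eq_zero hℓ _

/-- The space `V_{1/2} = {f ∈ H¹(0, ℓ) : f(0) = 0}`, as a type of its own, because its norm is not
the one of `V`. -/
def VHalf (ℓ : ℝ) : Type := vHalfSubmodule ℓ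

/-- The norm of `V_{1/2} = D(A^{1/2})` is `‖f‖_{1/2} = ‖f_x‖`. -/
instance instNormedAddCommGroupVHalf (ℓ : ℝ) : NormedAddCommGroup (VHalf ℓ) :=
  NormedAddCommGroup.induced (vHalfSubmodule ℓ) (V ℓ) (dxₗ ℓ) (dxₗ_injective ℓ)

/-- The inner product of `V_{1/2} = D(A^{1/2})` is `⟪f, h⟫_{1/2} = ⟪f_x, h_x⟫`. -/
instance instInnerProductSpaceVHalf (ℓ : ℝ) : InnerProductSpace ℝ (VHalf ℓ) :=
  InnerProductSpace.induced (dxₗ ℓ)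

/-- The inclusion `V_{1/2} ⊆ V` as a linear map. -/
def inclₗ (ℓ : ℝ) : VHalf ℓ →ₗ[ℝ] V ℓ where
  toFun f := f.1
  map_add' _ _ := rfl
  map_smul' _ _ := rfl

/-- The weak derivative `f ↦ f_x` from `V_{1/2}` to `V`. -/
def dx (ℓ : ℝ) : VHalf ℓ →ₗᵢ[ℝ] V ℓ where
  toFun f := dxₗ ℓ f
  map_add' := (dxₗ ℓ).map_add
  map_smul' := (dxₗ ℓ).map_smul
  norm_map' _ := rfl

theorem hasWeakDeriv_dx {ℓ : ℝ} (f : VHalf ℓ) : HasWeakDeriv (inclₗ ℓ f) (dx ℓ f) :=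
  (exists_weakDeriv f).choose_spec

theorem exists_rep {ℓ : ℝ} (f : VHalf ℓ) : ∃ F, IsContRep (inclₗ ℓ f) F ∧ F 0 = 0 := f.2.2

/-- The continuous representative of `f ∈ V_{1/2}`. -/
def rep {ℓ : ℝ} (f : VHalf ℓ) : ℝ → ℝ := (exists_rep f).choose

theorem isContRep_rep {ℓ : ℝ} (f : VHalf ℓ) : IsContRep (inclₗ ℓ f) (rep f) :=
  (exists_rep f).choose_spec.1

theorem rep_zero {ℓ : ℝ} (f : VHalf ℓ) : rep f 0 = 0 := (exists_rep f).choose_spec.2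

theorem rep_eq_integral {ℓ : ℝ} (hℓ : 0 < ℓ) (f : VHalf ℓ) {x : ℝ} (hx : x ∈ Icc 0 ℓ) :
    rep f x = ∫ s in (0 : ℝ)..x, dx ℓ f s := by
  rw [(isContRep_rep f).eq_integral hℓ (hasWeakDeriv_dx f) hx, rep_zero, zero_add]

/-- The continuous inclusion `V_{1/2} ⊆ V`. -/
def incl (ℓ : ℝ) : VHalf ℓ →L[ℝ] V ℓ :=
  (inclₗ ℓ).mkContinuous |ℓ| fun f => by
    by_cases hℓ : 0 < ℓ
    · rw [abs_of_pos hℓ]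
      exact norm_le_norm_dxₗ hℓ f
    · rw [V_eq_zero hℓ (inclₗ ℓ f), norm_zero]
      positivity

/-- The dual space `V_{-1/2}` of `V_{1/2}`. -/
abbrev VNegHalf (ℓ : ℝ) : Type := VHalf ℓ →L[ℝ] ℝ

/-- The Dirac mass `δ_ℓ ∈ V_{-1/2}` at the right end point, `⟨δ_ℓ, f⟩ = f(ℓ)`. -/
def dirac {ℓ : ℝ} (hℓ : 0 < ℓ) : VNegHalf ℓ :=
  LinearMap.mkContinuous
    { toFun := fun f => rep f ℓ
      map_add' := fun f f' => by
        have hm : ℓ ∈ Icc 0 ℓ := right_mem_Icc.2 hℓ.le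
        have h : IsContRep (inclₗ ℓ (f + f')) (rep f + rep f') := by
          rw [map_add]
          exact ⟨(isContRep_rep f).1.add (isContRep_rep f').1,
            (Lp.coeFn_add _ _).trans ((isContRep_rep f).2.add (isContRep_rep f').2)⟩
        have e := h.eq_integral hℓ (hasWeakDeriv_dx (f + f')) hm
        rw [← rep_eq_integral hℓ (f + f') hm] at e
        simpa [rep_zero] using e.symm
      map_smul' := fun c f => by
        have hm : ℓ ∈ Icc 0 ℓ := right_mem_Icc.2 hℓ.le
        have h : IsContRep (inclₗ ℓ (c • f)) (c • rep f) := by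
          rw [map_smul]
          exact ⟨(isContRep_rep f).1.const_smul c,
            (Lp.coeFn_smul _ _).trans ((isContRep_rep f).2.const_smul c)⟩
        have e := h.eq_integral hℓ (hasWeakDeriv_dx (c • f)) hm
        rw [← rep_eq_integral hℓ (c • f) hm] at e
        simpa [rep_zero] using e.symm } (√ℓ) fun f => by
    have hm : ℓ ∈ Icc 0 ℓ := right_mem_Icc.2 hℓ.le
    change |rep f ℓ| ≤ _
    rw [rep_eq_integral hℓ f hm]
    exact abs_integral_le hℓ _ hm

/-- The energy space `𝒱 = V_{1/2} × V` with its Hilbert norm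
`‖(y, z)‖² = ‖y_x‖² + ‖z‖²`. -/
abbrev Energy (ℓ : ℝ) : Type := WithLp 2 (VHalf ℓ × V ℓ)

/-- The extrapolation space `D(𝒜)' = V × V_{-1/2}`. -/
abbrev Extrapolation (ℓ : ℝ) : Type := WithLp 2 (V ℓ × VNegHalf ℓ)

/-- The embedding `𝒱 ⊆ V × V_{-1/2}`: in the second component `z ∈ V` is identified, with `V` as
pivot space, with the functional `φ ↦ ⟪z, φ⟫` on `V_{1/2}`. -/
def embed {ℓ : ℝ} (U : Energy ℓ) : Extrapolation ℓ :=
  WithLp.toLp 2 (incl ℓ U.fst, (innerSL ℝ U.snd).comp (incl ℓ))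

/-! ### The wave operator and its group -/

/-- The graph of the operator `A = -∂ₓ²` in `V` with domain
`V₁ = {y ∈ H²(0, ℓ) : y(0) = 0, y_x(ℓ) = 0}`: `y ∈ V₁` and `A y = f`. -/
def IsA {ℓ : ℝ} (y : VHalf ℓ) (f : V ℓ) : Prop :=
  HasWeakDeriv (dx ℓ y) (-f) ∧ HasTrace (dx ℓ y) ℓ 0

/-- The graph of the operator `𝒜 (y, z) = (z, -A y)` in `𝒱` with domain `V₁ × V_{1/2}`:
`U ∈ D(𝒜)` and `𝒜 U = W`. -/
def IsWaveOp {ℓ : ℝ} (U W : Energy ℓ) : Prop :=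
  incl ℓ W.fst = U.snd ∧ IsA U.fst (-W.snd)

/-- Strongly continuous one-parameter groups of bounded operators. -/
structure IsC0Group {E : Type*} [NormedAddCommGroup E] [NormedSpace ℝ E]
    (S : ℝ → E →L[ℝ] E) : Prop where
  map_zero : S 0 = ContinuousLinearMap.id ℝ E
  map_add : ∀ s t, S (s + t) = (S s).comp (S t)
  continuous : ∀ x, Continuous fun t => S t x

/-- `S` is the strongly continuous group on `𝒱` generated by `𝒜`. -/
structure IsWaveGroup {ℓ : ℝ} (S : ℝ → Energy ℓ →L[ℝ] Energy ℓ) : Prop where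
  isC0Group : IsC0Group S
  generator : ∀ U W : Energy ℓ, HasDerivAt (fun t => S t U) W 0 ↔ IsWaveOp U W

/-- `S₁` is the extension of the group `S` to a strongly continuous group on `V × V_{-1/2}`. -/
structure IsExtrapolatedGroup {ℓ : ℝ} (S : ℝ → Energy ℓ →L[ℝ] Energy ℓ)
    (S₁ : ℝ → Extrapolation ℓ →L[ℝ] Extrapolation ℓ) : Prop where
  isC0Group : IsC0Group S₁
  extends_group : ∀ (t : ℝ) (U : Energy ℓ), S₁ t (embed U) = embed (S t U)

/-! ### Solutions of the delayed system -/

/-- The Neumann datum at `x = ℓ` produced by the velocity trace `w = y_t(ℓ, ·)`: it is `0` for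
`t < 2ℓ` and `μ w(t - 2ℓ)` from then on. -/
def feedback (ℓ μ : ℝ) (w : ℝ → ℝ) (t : ℝ) : ℝ :=
  if t < 2 * ℓ then 0 else μ * w (t - 2 * ℓ)

/-- `Y = (y, y_t)` is a weak solution with finite energy, on `[0, ∞)`, of
`y_tt = y_xx` in `(0, ℓ)`, `y(0, t) = 0`, `y_x(ℓ, t) = 0` for `0 < t < 2ℓ`,
`y_x(ℓ, t) = μ y_t(ℓ, t - 2ℓ)` for `t > 2ℓ`, and `(y, y_t)(0) = U₀`,
where `w` is the velocity trace `y_t(ℓ, ·)`, that is, the locally square integrable weak derivative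
of the function `t ↦ y(ℓ, t)`.
The condition at `x = 0` is contained in `y(t) ∈ V_{1/2}`; the wave equation and the Neumann
condition `y_x(ℓ, t) = g(t)` are expressed together by the usual variational equation
`d/dt ⟪y_t, φ⟫ = -⟪y_x, φ_x⟫ + g(t) φ(ℓ)` for all test functions `φ ∈ V_{1/2}`,
integrated in time. -/
structure IsSolution {ℓ : ℝ} (hℓ : 0 < ℓ) (μ : ℝ) (U₀ : Energy ℓ) (Y : ℝ → Energy ℓ)
    (w : ℝ → ℝ) : Prop where
  continuousOn : ContinuousOn Y (Ici 0)
  velocity : ∀ t ∈ Ici (0 : ℝ),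
    HasDerivWithinAt (fun s => incl ℓ (Y s).fst) (Y t).snd (Ici 0) t
  trace_memLp : ∀ T : ℝ, MemLp w 2 (volume.restrict (Ioo 0 T))
  trace_eq : ∀ t ∈ Ici (0 : ℝ),
    dirac hℓ (Y t).fst = dirac hℓ (Y 0).fst + ∫ s in (0 : ℝ)..t, w s
  wave : ∀ φ : VHalf ℓ, ∀ t ∈ Ici (0 : ℝ),
    inner ℝ (Y t).snd (incl ℓ φ) = inner ℝ (Y 0).snd (incl ℓ φ) +
      ∫ s in (0 : ℝ)..t, (-inner ℝ (dx ℓ (Y s).fst) (dx ℓ φ) + feedback ℓ μ w s * dirac hℓ φ)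
  initial : Y 0 = U₀

end SwitchingDelayWave

end

open SwitchingDelayWave

noncomputable section

namespace SwitchingDelayWave

/-! ### Integration by parts and primitives -/

/-! The unbounded generator 𝒜 is replaced by its inverse `R = invWave`, a bounded, injective,
skew-symmetric operator on the energy space, and the control vector (0, δ_ℓ) by its image `b =
invDirac` under the inverse of the extended operator. The variational problem becomes one equation
in the energy space, R Y(t) = R Y(0) + ∫ Y + (∫ g) b (`invWave_eq_iff`).

Existence comes from d'Alembert's formula. Riemann invariants h(t ± x) satisfy the condition at 0,
and their Neumann datum at ℓ is (h(t + ℓ) + h(t - ℓ))/2 (`invWave_wave`). If h is made of copies of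
one profile on windows of length 2ℓ with coefficients aₙ, then the boundary condition is a recursion
for aₙ: aₙ₊₁ = -aₙ for the free wave (`isOrbit_freeWave`), a two-term recursion for the delayed one
(`feedback_delayCoeff`).

Skew-symmetry gives conservation of energy for free orbits (`IsOrbit.norm_eq`), so they are unique
and form an isometry group. A duality argument gives the formula of `variation_of_constants`; the
isomorphism `waveExt` carries it to V × V_{-1/2}, where it is the stated explicit form.

Uniqueness: a solution vanishing up to time 2nℓ has zero velocity trace there, so no feedback before
2(n + 1)ℓ, and it stays zero. Continuous dependence: by uniqueness the difference of two solutions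
is an explicit wave, which is dominated by the free wave with the same data. -/

theorem integral_primitive_mul {a b : ℝ} {v g : ℝ → ℝ} (hv : IntervalIntegrable v volume a b)
    (hg : IntervalIntegrable g volume a b) (c : ℝ) :
    ∫ x in a..b, (c + ∫ s in a..x, v s) * g x =
      (c + ∫ s in a..b, v s) * (∫ s in a..b, g s) - ∫ x in a..b, v x * ∫ s in a..x, g s := by
  have hV := hv.absolutelyContinuousOnInterval_intervalIntegral (c := a) left_mem_uIcc
  have hG := hg.absolutelyContinuousOnInterval_intervalIntegral (c := a) left_mem_uIcc
  have hVi : IntervalIntegrable (fun x => ∫ s in a..x, v s) volume a b :=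
    hV.continuousOn.intervalIntegrable
  -- Both primitives are absolutely continuous, so integration by parts is available for merely
  -- integrable `v` and `g`; the derivatives are identified almost everywhere.
  have key := hV.integral_mul_deriv_eq_deriv_mul hG
  have e1 : ∫ x in a..b, (∫ s in a..x, v s) * deriv (fun x => ∫ s in a..x, g s) x =
      ∫ x in a..b, (∫ s in a..x, v s) * g x := by
    refine intervalIntegral.integral_congr_ae ?_
    filter_upwards [hg.ae_hasDerivAt_integral] with x hx hxm
    rw [(hx (uIoc_subset_uIcc hxm) a left_mem_uIcc).deriv]
  have e2 : ∫ x in a..b, deriv (fun x => ∫ s in a..x, v s) x * (∫ s in a..x, g s) =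
      ∫ x in a..b, v x * ∫ s in a..x, g s := by
    refine intervalIntegral.integral_congr_ae ?_
    filter_upwards [hv.ae_hasDerivAt_integral] with x hx hxm
    rw [(hx (uIoc_subset_uIcc hxm) a left_mem_uIcc).deriv]
  rw [e1, e2, intervalIntegral.integral_same, intervalIntegral.integral_same] at key
  simp only [add_mul]
  rw [intervalIntegral.integral_add (hg.const_mul c)
    (hg.continuousOn_mul hV.continuousOn), intervalIntegral.integral_const_mul, key]
  ring

variable {ℓ : ℝ}

theorem intervalIntegrable_V (hℓ : 0 < ℓ) (f : V ℓ) : IntervalIntegrable f volume 0 ℓ :=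
  (intervalIntegrable_iff_integrableOn_Ioo_of_le hℓ.le).2 (integrableOn_V f)

theorem setIntegral_Ioo_eq (hℓ : 0 < ℓ) (f : ℝ → ℝ) :
    ∫ x in Ioo 0 ℓ, f x = ∫ x in (0 : ℝ)..ℓ, f x := by
  rw [intervalIntegral.integral_of_le hℓ.le, integral_Ioc_eq_integral_Ioo]

theorem inner_V_eq (hℓ : 0 < ℓ) (f g : V ℓ) : inner ℝ f g = ∫ x in (0 : ℝ)..ℓ, f x * g x := by
  rw [L2.inner_def, ← setIntegral_Ioo_eq hℓ]
  refine integral_congr_ae (Filter.Eventually.of_forall fun x => ?_)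
  simp [mul_comm]

/-- Interval integrals inside `[0, ℓ]` only see functions up to a.e. equality on `(0, ℓ)`. -/
theorem integral_congr_V {f g : ℝ → ℝ} (h : f =ᵐ[volume.restrict (Ioo 0 ℓ)] g) {a b : ℝ}
    (ha : a ∈ Icc 0 ℓ) (hb : b ∈ Icc 0 ℓ) : ∫ x in a..b, f x = ∫ x in a..b, g x := by
  refine intervalIntegral.integral_congr_ae ?_
  rw [Filter.EventuallyEq, ae_restrict_iff' measurableSet_Ioo] at h
  -- Interval integrals run over half-open intervals, so the end point ℓ has to be discarded.
  have hne : ∀ᵐ x : ℝ, x ≠ ℓ := by rw [ae_iff]; simp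
  filter_upwards [h, hne] with x hx hxℓ hxm
  have h1 := (le_min ha.1 hb.1).trans_lt hxm.1
  have h2 := hxm.2.trans (max_le ha.2 hb.2)
  exact hx ⟨h1, lt_of_le_of_ne h2 hxℓ⟩

open Classical in
/-- The class in `L²(0, ℓ)` of a function, and `0` if the function is not square integrable. -/
def toV (ℓ : ℝ) (f : ℝ → ℝ) : V ℓ :=
  if h : MemLp f 2 (volume.restrict (Ioo 0 ℓ)) then h.toLp f else 0

theorem coeFn_toV {f : ℝ → ℝ} (h : MemLp f 2 (volume.restrict (Ioo 0 ℓ))) :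
    toV ℓ f =ᵐ[volume.restrict (Ioo 0 ℓ)] f := by
  rw [toV, dif_pos h]
  exact h.coeFn_toLp

theorem memLp_of_continuousOn {f : ℝ → ℝ} (h : ContinuousOn f (Icc 0 ℓ)) :
    MemLp f 2 (volume.restrict (Ioo 0 ℓ)) := by
  obtain ⟨C, hC⟩ := isCompact_Icc.exists_bound_of_continuousOn h
  refine MemLp.of_bound ((h.mono Ioo_subset_Icc_self).aestronglyMeasurable measurableSet_Ioo) C ?_
  filter_upwards [ae_restrict_mem measurableSet_Ioo] with x hx
  exact hC x (Ioo_subset_Icc_self hx)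

theorem continuousOn_primitive_V (hℓ : 0 < ℓ) (g : V ℓ) (c : ℝ) :
    ContinuousOn (fun x => c + ∫ s in (0 : ℝ)..x, g s) (Icc 0 ℓ) := by
  have := ((intervalIntegrable_V hℓ g).absolutelyContinuousOnInterval_intervalIntegral
    (c := 0) left_mem_uIcc).continuousOn
  rw [uIcc_of_le hℓ.le] at this
  exact continuousOn_const.add this

/-- A primitive `x ↦ c + ∫₀ˣ g` has weak derivative `g`. -/
theorem hasWeakDeriv_primitive (hℓ : 0 < ℓ) (g : V ℓ) (c : ℝ) {f : V ℓ}
    (hf : f =ᵐ[volume.restrict (Ioo 0 ℓ)] fun x => c + ∫ s in (0 : ℝ)..x, g s) :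
    HasWeakDeriv f g := by
  intro φ hφ hc hs
  have hd : Continuous (deriv φ) := (contDiff_infty_iff_deriv.1 hφ).2.continuous
  have hφ0 : φ 0 = 0 := image_eq_zero_of_notMem_tsupport fun h => lt_irrefl _ (hs h).1
  have hφℓ : φ ℓ = 0 := image_eq_zero_of_notMem_tsupport fun h => lt_irrefl _ (hs h).2
  have hint : ∀ x, ∫ s in (0 : ℝ)..x, deriv φ s = φ x := fun x => by
    rw [intervalIntegral.integral_deriv_eq_sub
      (fun y _ => (hφ.differentiable (by simp)).differentiableAt)
      (hd.intervalIntegrable _ _), hφ0, sub_zero]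
  have key := integral_primitive_mul (intervalIntegrable_V hℓ g) (hd.intervalIntegrable 0 ℓ) c
  simp only [hint, hφℓ, mul_zero, zero_sub] at key
  rw [setIntegral_Ioo_eq hℓ, setIntegral_Ioo_eq hℓ, ← key]
  refine integral_congr_V ?_ (left_mem_Icc.2 hℓ.le) (right_mem_Icc.2 hℓ.le)
  filter_upwards [hf] with x hx
  rw [hx]

/-- The primitive of `g ∈ L²(0, ℓ)` that vanishes at `0`, as an element of `V_{1/2}`. -/
def prim (hℓ : 0 < ℓ) (g : V ℓ) : VHalf ℓ :=
  ⟨toV ℓ fun x => 0 + ∫ s in (0 : ℝ)..x, g s,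
    ⟨g, hasWeakDeriv_primitive hℓ g 0
      (coeFn_toV (memLp_of_continuousOn (continuousOn_primitive_V hℓ g 0)))⟩,
    _, ⟨continuousOn_primitive_V hℓ g 0,
      coeFn_toV (memLp_of_continuousOn (continuousOn_primitive_V hℓ g 0))⟩, by simp⟩

theorem dx_prim (hℓ : 0 < ℓ) (g : V ℓ) : dx ℓ (prim hℓ g) = g :=
  (hasWeakDeriv_dx (prim hℓ g)).unique (hasWeakDeriv_primitive hℓ g 0
      (coeFn_toV (memLp_of_continuousOn (continuousOn_primitive_V hℓ g 0))))

theorem dx_surjective (hℓ : 0 < ℓ) : Function.Surjective (dx ℓ) :=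
  fun g => ⟨_, dx_prim hℓ g⟩

/-- `dx` is an isometry onto L², so completeness is inherited. Adjoints, the Riesz isomorphism and
Bochner integrals rely on it. -/
theorem completeSpace_VHalf (hℓ : 0 < ℓ) : CompleteSpace (VHalf ℓ) :=
  (completeSpace_congr (e := Equiv.ofBijective _ ⟨(dx ℓ).injective, dx_surjective hℓ⟩)
    (dx ℓ).isometry.isUniformEmbedding).2 inferInstance

theorem coeFn_incl (hℓ : 0 < ℓ) (f : VHalf ℓ) :
    incl ℓ f =ᵐ[volume.restrict (Ioo 0 ℓ)] fun x => ∫ s in (0 : ℝ)..x, dx ℓ f s := by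
  have h := (isContRep_rep f).2
  filter_upwards [h, ae_restrict_mem measurableSet_Ioo] with x hx hxm
  exact hx.trans (rep_eq_integral hℓ f (Ioo_subset_Icc_self hxm))

theorem incl_injective : Function.Injective (incl ℓ) := fun _ _ h => Subtype.ext h

theorem dirac_apply (hℓ : 0 < ℓ) (f : VHalf ℓ) : dirac hℓ f = ∫ s in (0 : ℝ)..ℓ, dx ℓ f s :=
  rep_eq_integral hℓ f (right_mem_Icc.2 hℓ.le)

theorem inner_VHalf (f g : VHalf ℓ) : inner ℝ f g = inner ℝ (dx ℓ f) (dx ℓ g) :=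
  ((dx ℓ).inner_map_map f g).symm

/-- Integration by parts against elements of `V_{1/2}`. -/
theorem inner_primitive (hℓ : 0 < ℓ) (v : V ℓ) (c : ℝ) {f : V ℓ}
    (hf : f =ᵐ[volume.restrict (Ioo 0 ℓ)] fun x => c + ∫ s in (0 : ℝ)..x, v s) (φ : VHalf ℓ) :
    inner ℝ f (dx ℓ φ) = (c + ∫ s in (0 : ℝ)..ℓ, v s) * dirac hℓ φ - inner ℝ v (incl ℓ φ) := by
  have hl := left_mem_Icc.2 hℓ.le
  have hr := right_mem_Icc.2 hℓ.le
  rw [inner_V_eq hℓ, inner_V_eq hℓ, dirac_apply hℓ]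
  have key := integral_primitive_mul (intervalIntegrable_V hℓ v) (intervalIntegrable_V hℓ (dx ℓ φ)) c
  rw [integral_congr_V (g := fun x => (c + ∫ s in (0 : ℝ)..x, v s) * dx ℓ φ x) ?_ hl hr, key,
    integral_congr_V (f := fun x => v x * incl ℓ φ x)
      (g := fun x => v x * ∫ s in (0 : ℝ)..x, dx ℓ φ s) ?_ hl hr]
  · filter_upwards [coeFn_incl hℓ φ] with x hx
    rw [hx]
  · filter_upwards [hf] with x hx
    rw [hx]

/-! ### The inverse of the wave operator -/

/-- The inverse of `A`, from `V` to `V_{1/2}`: the function `x ↦ ∫₀ˣ ∫ᵣ^ℓ v`. -/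
def invA (hℓ : 0 < ℓ) : V ℓ →L[ℝ] VHalf ℓ :=
  haveI := completeSpace_VHalf hℓ
  -- The weak form of A y = v is ⟪y, φ⟫_{1/2} = ⟪v, φ⟫ for all φ, which says that A⁻¹ is the adjoint
  -- of the inclusion.
  ContinuousLinearMap.adjoint (incl ℓ)

theorem inner_invA (hℓ : 0 < ℓ) (v : V ℓ) (φ : VHalf ℓ) :
    inner ℝ (invA hℓ v) φ = inner ℝ v (incl ℓ φ) :=
  haveI := completeSpace_VHalf hℓ
  ContinuousLinearMap.adjoint_inner_left (incl ℓ) φ v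

/-- Every g in L² is some `dx ℓ φ`, so both sides can be compared by testing. The constant makes the
primitive vanish at ℓ, which removes the boundary term. -/
theorem coeFn_dx_invA (hℓ : 0 < ℓ) (v : V ℓ) :
    dx ℓ (invA hℓ v) =ᵐ[volume.restrict (Ioo 0 ℓ)]
      fun x => (∫ s in (0 : ℝ)..ℓ, v s) + ∫ s in (0 : ℝ)..x, (-v) s := by
  have hm := memLp_of_continuousOn (continuousOn_primitive_V hℓ (-v) (∫ s in (0 : ℝ)..ℓ, v s))
  have he : dx ℓ (invA hℓ v) = toV ℓ
      (fun x => (∫ s in (0 : ℝ)..ℓ, v s) + ∫ s in (0 : ℝ)..x, (-v : V ℓ) s) := by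
    refine ext_inner_right ℝ fun g => ?_
    obtain ⟨φ, rfl⟩ := dx_surjective hℓ g
    have h0 : ∫ s in (0 : ℝ)..ℓ, (-v : V ℓ) s = -∫ s in (0 : ℝ)..ℓ, v s := by
      rw [← intervalIntegral.integral_neg]
      exact integral_congr_V (Lp.coeFn_neg v) (left_mem_Icc.2 hℓ.le) (right_mem_Icc.2 hℓ.le)
    rw [← inner_VHalf, inner_invA, inner_primitive hℓ (-v) _ (coeFn_toV hm), h0, inner_neg_left]
    ring
  rw [he]
  exact coeFn_toV hm

/-- The graph of `A` in variational form. -/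
theorem isA_iff (hℓ : 0 < ℓ) (y : VHalf ℓ) (f : V ℓ) : IsA y f ↔ y = invA hℓ f := by
  constructor
  · rintro ⟨hw, F, hF, hFℓ⟩
    refine ext_inner_right ℝ fun φ => ?_
    have hae : dx ℓ y =ᵐ[volume.restrict (Ioo 0 ℓ)]
        fun x => F 0 + ∫ s in (0 : ℝ)..x, (-f : V ℓ) s := by
      filter_upwards [hF.2, ae_restrict_mem measurableSet_Ioo] with x hx hxm
      rw [hx, hF.eq_integral hℓ hw (Ioo_subset_Icc_self hxm)]
    rw [inner_VHalf, inner_primitive hℓ _ _ hae,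
      ← hF.eq_integral hℓ hw (right_mem_Icc.2 hℓ.le), hFℓ, inner_invA, inner_neg_left]
    ring
  · rintro rfl
    refine ⟨hasWeakDeriv_primitive hℓ _ _ (coeFn_dx_invA hℓ f), _,
      ⟨continuousOn_primitive_V hℓ (-f) _, coeFn_dx_invA hℓ f⟩, ?_⟩
    rw [integral_congr_V (Lp.coeFn_neg f) (left_mem_Icc.2 hℓ.le) (right_mem_Icc.2 hℓ.le)]
    simp

/-- The bounded inverse `(y, z) ↦ (-A⁻¹ z, y)` of the wave operator. -/
def invWave (hℓ : 0 < ℓ) : Energy ℓ →L[ℝ] Energy ℓ :=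
  (WithLp.prodContinuousLinearEquiv 2 ℝ (VHalf ℓ) (V ℓ)).symm.toContinuousLinearMap.comp
    ((-(invA hℓ).comp (WithLp.sndL 2 ℝ (VHalf ℓ) (V ℓ))).prod
      ((incl ℓ).comp (WithLp.fstL 2 ℝ (VHalf ℓ) (V ℓ))))

theorem invWave_fst (hℓ : 0 < ℓ) (U : Energy ℓ) : (invWave hℓ U).fst = -invA hℓ U.snd := rfl

theorem invWave_snd (hℓ : 0 < ℓ) (U : Energy ℓ) : (invWave hℓ U).snd = incl ℓ U.fst := rfl

theorem energy_ext {U W : Energy ℓ} (h1 : U.fst = W.fst) (h2 : U.snd = W.snd) : U = W :=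
  WithLp.ofLp_injective 2 (Prod.ext h1 h2)

theorem isWaveOp_iff (hℓ : 0 < ℓ) (U W : Energy ℓ) : IsWaveOp U W ↔ U = invWave hℓ W := by
  rw [IsWaveOp, isA_iff hℓ, map_neg]
  exact ⟨fun h => energy_ext h.2 h.1.symm, fun h => by rw [h]; exact ⟨rfl, rfl⟩⟩

/-- If R W = 0, then both W and 0 are values of 𝒜 at 0; injectivity of the inclusion and uniqueness
of weak derivatives identify them. -/
theorem invWave_injective (hℓ : 0 < ℓ) : Function.Injective (invWave hℓ) := by
  refine (injective_iff_map_eq_zero _).2 fun W hW => ?_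
  have h := (isWaveOp_iff hℓ 0 W).2 hW.symm
  have h0 := (isWaveOp_iff hℓ 0 0).2 (map_zero _).symm
  refine energy_ext (incl_injective (h.1.trans h0.1.symm)) ?_
  have := h.2.1.unique h0.2.1
  simpa using this

theorem inner_energy (U W : Energy ℓ) :
    inner ℝ U W = inner ℝ U.fst W.fst + inner ℝ U.snd W.snd := rfl

/-- The two terms cancel because `invA` and `incl` are adjoint. This is the source of energy
conservation. -/
theorem inner_invWave_self (hℓ : 0 < ℓ) (U : Energy ℓ) : inner ℝ (invWave hℓ U) U = 0 := by
  rw [inner_energy, invWave_fst, invWave_snd, inner_neg_left, inner_invA, real_inner_comm]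
  ring

/-- The element `(-d, 0)`, `d(x) = x`, of the energy space: the image of `(0, δ_ℓ)` under the inverse
of the wave operator. -/
def invDirac (hℓ : 0 < ℓ) : Energy ℓ := WithLp.toLp 2 (-prim hℓ (toV ℓ fun _ => 1), 0)

/-- The function x ↦ x is the Riesz representative of δ_ℓ, since its derivative is 1. -/
theorem inner_prim_one (hℓ : 0 < ℓ) (φ : VHalf ℓ) :
    inner ℝ (prim hℓ (toV ℓ fun _ => 1)) φ = dirac hℓ φ := by
  rw [inner_VHalf, dx_prim, inner_V_eq hℓ, dirac_apply hℓ]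
  refine integral_congr_V ?_ (left_mem_Icc.2 hℓ.le) (right_mem_Icc.2 hℓ.le)
  filter_upwards [coeFn_toV (ℓ := ℓ) (memLp_const (1 : ℝ))] with x hx
  rw [hx, one_mul]

/-! ### Groups generated by the inverse of a skew-adjoint injection -/

section SkewAdjoint

variable {E : Type*} [NormedAddCommGroup E] [InnerProductSpace ℝ E] {R : E →L[ℝ] E}

/-- `Y` is an integrated solution on `ℝ` of `Y' = R⁻¹ Y`. -/
structure IsOrbit (R : E →L[ℝ] E) (Y : ℝ → E) : Prop where
  continuous : Continuous Y
  eq_integral : ∀ t, R (Y t) = R (Y 0) + ∫ s in (0 : ℝ)..t, Y s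

theorem inner_skew (hskew : ∀ U, inner ℝ (R U) U = 0) (U W : E) :
    inner ℝ (R U) W = -inner ℝ U (R W) := by
  have h := hskew (U + W)
  rw [map_add, inner_add_left, inner_add_right, inner_add_right, hskew, hskew,
    real_inner_comm U (R W)] at h
  linarith

theorem IsC0Group.apply_zero {F : Type*} [NormedAddCommGroup F] [NormedSpace ℝ F]
    {S : ℝ → F →L[ℝ] F} (hS : IsC0Group S) (U : F) : S 0 U = U := by
  rw [hS.map_zero]; rfl

theorem IsC0Group.apply_neg_apply {F : Type*} [NormedAddCommGroup F] [NormedSpace ℝ F]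
    {S : ℝ → F →L[ℝ] F} (hS : IsC0Group S) (t : ℝ) (U : F) : S t (S (-t) U) = U := by
  rw [← ContinuousLinearMap.comp_apply, ← hS.map_add, add_neg_cancel, hS.apply_zero]

variable {S : ℝ → E →L[ℝ] E}

theorem inner_group_left (hS : IsC0Group S) (hn : ∀ t U, ‖S t U‖ = ‖U‖) (t : ℝ) (U W : E) :
    inner ℝ (S t U) W = inner ℝ U (S (-t) W) := by
  have h : ∀ X X', inner ℝ (S t X) (S t X') = inner ℝ X X' :=
    (⟨(S t).toLinearMap, hn t⟩ : E →ₗᵢ[ℝ] E).inner_map_map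
  rw [← h U, hS.apply_neg_apply]

variable [CompleteSpace E]

namespace IsOrbit

variable {Y Y' : ℝ → E}

/-- An orbit need not be differentiable, but its image under R is. With `of_hasDerivAt` this
characterises orbits, so stability under linear combinations, time shifts and R reduces to
differentiation rules. -/
theorem hasDerivAt (h : IsOrbit R Y) (t : ℝ) : HasDerivAt (fun t => R (Y t)) (Y t) t := by
  have h1 := (h.continuous.integral_hasStrictDerivAt 0 t).hasDerivAt.const_add (R (Y 0))
  exact h1.congr_of_eventuallyEq (Filter.Eventually.of_forall h.eq_integral)

theorem of_hasDerivAt (hc : Continuous Y) (h : ∀ t, HasDerivAt (fun t => R (Y t)) (Y t) t) :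
    IsOrbit R Y := by
  refine ⟨hc, fun t => ?_⟩
  rw [intervalIntegral.integral_eq_sub_of_hasDerivAt (fun s _ => h s) (hc.intervalIntegrable _ _)]
  abel

theorem sub (h : IsOrbit R Y) (h' : IsOrbit R Y') : IsOrbit R (fun t => Y t - Y' t) :=
  of_hasDerivAt (h.continuous.sub h'.continuous) fun t => by
    simpa only [map_sub] using (h.hasDerivAt t).fun_sub (h'.hasDerivAt t)

theorem add (h : IsOrbit R Y) (h' : IsOrbit R Y') : IsOrbit R (fun t => Y t + Y' t) :=
  of_hasDerivAt (h.continuous.add h'.continuous) fun t => by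
    simpa only [map_add] using (h.hasDerivAt t).fun_add (h'.hasDerivAt t)

theorem smul (h : IsOrbit R Y) (c : ℝ) : IsOrbit R (fun t => c • Y t) :=
  of_hasDerivAt (h.continuous.const_smul c) fun t => by
    simpa only [map_smul] using (h.hasDerivAt t).fun_const_smul c

theorem shift (h : IsOrbit R Y) (r : ℝ) : IsOrbit R (fun t => Y (t + r)) :=
  of_hasDerivAt (h.continuous.comp (continuous_id.add continuous_const)) fun t =>
    (h.hasDerivAt (t + r)).comp_add_const t r

theorem map (h : IsOrbit R Y) : IsOrbit R (fun t => R (Y t)) :=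
  of_hasDerivAt (R.continuous.comp h.continuous) fun t =>
    R.hasFDerivAt.comp_hasDerivAt t (h.hasDerivAt t)

theorem norm_map_eq (hskew : ∀ U, inner ℝ (R U) U = 0) (h : IsOrbit R Y) (t : ℝ) :
    ‖R (Y t)‖ = ‖R (Y 0)‖ := by
  have hd : ∀ t, HasDerivAt (fun t => ‖R (Y t)‖ ^ 2) 0 t := fun t => by
    have := (h.hasDerivAt t).norm_sq
    rwa [hskew, mul_zero] at this
  have := is_const_of_deriv_eq_zero (fun t => (hd t).differentiableAt) (fun t => (hd t).deriv) t 0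
  exact (sq_eq_sq₀ (norm_nonneg _) (norm_nonneg _)).1 this

/-- The energy of Y cannot be differentiated directly. The difference quotients ε⁻¹(Y(· + ε) - Y)
are orbits, so their images under R have constant norm by `norm_map_eq`; as ε → 0 these images tend
to Y. -/
theorem norm_eq (hskew : ∀ U, inner ℝ (R U) U = 0) (h : IsOrbit R Y) (t : ℝ) :
    ‖Y t‖ = ‖Y 0‖ := by
  have hl : ∀ t, Filter.Tendsto (fun ε : ℝ => ‖R (ε⁻¹ • (Y (t + ε) - Y t))‖) (nhdsWithin 0 {0}ᶜ)
      (nhds ‖Y t‖) := fun t => by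
    have := (hasDerivAt_iff_tendsto_slope_zero.1 (h.hasDerivAt t)).norm
    simpa only [map_smul, map_sub] using this
  refine tendsto_nhds_unique (hl t) ((hl 0).congr fun ε => ?_)
  exact (((h.shift ε).sub h).smul ε⁻¹).norm_map_eq hskew t |>.symm

theorem eq_of_zero (hskew : ∀ U, inner ℝ (R U) U = 0) (h : IsOrbit R Y) (h' : IsOrbit R Y')
    (h0 : Y 0 = Y' 0) (t : ℝ) : Y t = Y' t := by
  have := (h.sub h').norm_eq hskew t
  rwa [h0, sub_self, norm_zero, norm_eq_zero, sub_eq_zero] at this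

end IsOrbit

/-- If every vector starts an orbit, then the orbits form a group of isometries. -/
theorem exists_group (hskew : ∀ U, inner ℝ (R U) U = 0)
    (hex : ∀ U, ∃ Y, IsOrbit R Y ∧ Y 0 = U) :
    ∃ S : ℝ → E →L[ℝ] E, IsC0Group S ∧ (∀ t U, ‖S t U‖ = ‖U‖) ∧
      ∀ U, IsOrbit R fun t => S t U := by
  choose Y hY hY0 using hex
  -- Linearity and the group law follow from uniqueness of orbits, since sums, multiples and shifts
  -- of orbits are orbits.
  let S : ℝ → E →L[ℝ] E := fun t =>
    LinearMap.mkContinuous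
      { toFun := fun U => Y U t
        map_add' := fun U W => (hY _).eq_of_zero hskew ((hY U).add (hY W)) (by simp only [hY0]) t
        map_smul' := fun c U => (hY _).eq_of_zero hskew ((hY U).smul c) (by simp only [hY0]) t }
      1 fun U => by
        change ‖Y U t‖ ≤ _
        rw [(hY U).norm_eq hskew, hY0, one_mul]
  refine ⟨S, ⟨?_, fun s t => ?_, fun U => (hY U).continuous⟩,
    fun t U => ((hY U).norm_eq hskew t).trans (by rw [hY0]), hY⟩
  · ext1 U
    exact hY0 U
  · ext1 U
    refine ((hY U).shift t).eq_of_zero hskew (hY (Y U t)) ?_ s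
    simp only [zero_add, hY0]

theorem group_comm (hskew : ∀ U, inner ℝ (R U) U = 0) (hS : IsC0Group S)
    (hR : ∀ U, IsOrbit R fun t => S t U) (t : ℝ) (U : E) : S t (R U) = R (S t U) :=
  (hR (R U)).eq_of_zero hskew (hR U).map (by simp only [hS.apply_zero]) t

/-- The generator of the group of orbits of `R⁻¹` is `R⁻¹`. -/
theorem hasDerivAt_group_iff (hskew : ∀ U, inner ℝ (R U) U = 0) (hS : IsC0Group S)
    (hR : ∀ U, IsOrbit R fun t => S t U) (U W : E) :
    HasDerivAt (fun t => S t U) W 0 ↔ U = R W := by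
  constructor
  · intro h
    -- R S(t) U has derivative R W at 0 by the chain rule, and derivative U because S(t) U is an
    -- orbit.
    have h1 := (R.hasFDerivAt (x := S 0 U)).comp_hasDerivAt 0 h
    have h2 := (hR U).hasDerivAt 0
    have := h2.unique h1
    rwa [hS.apply_zero] at this
  · rintro rfl
    have h := (hR W).hasDerivAt 0
    rw [hS.apply_zero] at h
    exact h.congr_of_eventuallyEq
      (Filter.Eventually.of_forall fun t => group_comm hskew hS hR t W)

/-- Variation of constants for integrated solutions of `Y' = R⁻¹ (Y + g b)`, with a merely integrable
scalar control `g`. -/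
theorem variation_of_constants (hskew : ∀ U, inner ℝ (R U) U = 0) (hinj : Function.Injective R)
    (hS : IsC0Group S) (hn : ∀ t U, ‖S t U‖ = ‖U‖) (hR : ∀ U, IsOrbit R fun t => S t U)
    {a t : ℝ} (hat : a ≤ t) {Y : ℝ → E} (hY : ContinuousOn Y (Icc a t)) {g : ℝ → ℝ}
    (hg : IntervalIntegrable g volume a t) {b : E}
    (h : ∀ s ∈ Icc a t, R (Y s) = R (Y a) + (∫ r in a..s, Y r) + (∫ r in a..s, g r) • b) :
    R (Y t) = S (t - a) (R (Y a)) + ∫ s in a..t, g s • S (t - s) b := by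
  set G : ℝ → ℝ := fun s => ∫ r in a..s, g r with hG
  have hGc : ContinuousOn G (Icc a t) := by
    have := (hg.absolutelyContinuousOnInterval_intervalIntegral (c := a) left_mem_uIcc).continuousOn
    rwa [uIcc_of_le hat] at this
  have hSb : Continuous fun s => S (t - s) b :=
    (hS.continuous b).comp (continuous_const.sub continuous_id)
  have hint : IntervalIntegrable (fun s => g s • S (t - s) b) volume a t :=
    hg.smul_continuousOn hSb.continuousOn
  -- One more application of R costs nothing, by injectivity. By skewness the defect is then tested
  -- only against vectors R W, whose backward orbit `p = R q` is differentiable with derivative `q`.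
  suffices hX : R (R (Y t) - S (t - a) (R (Y a)) - ∫ s in a..t, g s • S (t - s) b) = 0 by
    have := hinj (hX.trans (map_zero R).symm)
    rw [sub_sub, sub_eq_zero] at this
    exact this
  refine ext_inner_right ℝ fun W => ?_
  rw [inner_skew hskew, inner_zero_left, neg_eq_zero, inner_sub_left, inner_sub_left,
    inner_group_left hS hn]
  set p : ℝ → E := fun s => R (S (s - t) W) with hp
  set q : ℝ → E := fun s => S (s - t) W with hq
  have hqc : Continuous q := (hS.continuous W).comp (continuous_id.sub continuous_const)
  have hpc : Continuous p := R.continuous.comp hqc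
  have hpd : ∀ s, HasDerivAt p (q s) s := fun s => by
    have := ((hR W).hasDerivAt (s - t)).comp_sub_const s t
    exact this
  -- the derivative of the regular part
  have hZd : ∀ s ∈ Ioo a t, HasDerivAt (fun s => R (Y s) - G s • b) (Y s) s := by
    intro s hs
    have hYs : ContinuousAt Y s := hY.continuousAt (Icc_mem_nhds hs.1 hs.2)
    have h1 : HasDerivAt (fun u => ∫ r in a..u, Y r) (Y s) s := by
      refine intervalIntegral.integral_hasDerivAt_right
        ((hY.mono ?_).intervalIntegrable) ?_ hYs
      · rw [uIcc_of_le hs.1.le]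
        exact Icc_subset_Icc_right hs.2.le
      · exact (hY.mono Ioo_subset_Icc_self).stronglyMeasurableAtFilter isOpen_Ioo s hs
    refine (h1.const_add (R (Y a))).congr_of_eventuallyEq ?_
    filter_upwards [Ioo_mem_nhds hs.1 hs.2] with u hu
    rw [h u (Ioo_subset_Icc_self hu)]
    abel
  -- R Y - G b is differentiable with derivative Y. In the derivative of its pairing with p, the
  -- terms ⟪Y, R q⟫ and ⟪R Y, q⟫ cancel, leaving only -G ⟪b, q⟫.
  have hFTC := intervalIntegral.integral_eq_sub_of_hasDerivAt_of_le hat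
    (f := fun s => inner ℝ (R (Y s) - G s • b) (p s)) (f' := fun s => -(G s * inner ℝ b (q s)))
    (((R.continuous.comp_continuousOn hY).sub (hGc.smul continuousOn_const)).inner
      hpc.continuousOn) ?_ ?_
  rotate_left
  · intro s hs
    have := (hZd s hs).inner ℝ (hpd s)
    refine this.congr_deriv ?_
    rw [inner_sub_left, inner_skew hskew, real_inner_smul_left]
    simp only [hp, hq]
    ring
  · refine ContinuousOn.intervalIntegrable ?_
    rw [uIcc_of_le hat]
    exact (hGc.mul (continuous_const.inner hqc).continuousOn).neg
  have hc : ∀ s, inner ℝ b (p a) + ∫ r in a..s, inner ℝ b (q r) = inner ℝ b (p s) := fun s => by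
    have hd : ∀ r, HasDerivAt (fun r => inner ℝ b (p r)) (inner ℝ b (q r)) r := fun r => by
      simpa using (hasDerivAt_const r b).inner ℝ (hpd r)
    rw [intervalIntegral.integral_eq_sub_of_hasDerivAt (fun r _ => hd r)
      ((continuous_const.inner hqc).intervalIntegrable _ _)]
    ring
  -- The control integral is tested against R W and integrated by parts as a scalar integral, so g
  -- need only be integrable.
  have hIBP := integral_primitive_mul
    ((continuous_const.inner hqc : Continuous fun s => inner ℝ b (q s)).intervalIntegrable a t)
    hg (inner ℝ b (p a))
  simp only [hc] at hIBP
  have hI : inner ℝ (∫ s in a..t, g s • S (t - s) b) (R W) = ∫ s in a..t, inner ℝ b (p s) * g s := by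
    rw [real_inner_comm, ← innerSL_apply_apply ℝ, ← ContinuousLinearMap.intervalIntegral_comp_comm _ hint]
    refine intervalIntegral.integral_congr fun s _ => ?_
    simp only [innerSL_apply_apply, real_inner_smul_right]
    rw [real_inner_comm, inner_group_left hS hn, neg_sub, group_comm hskew hS hR]
    exact mul_comm _ _
  have hpt : p t = R W := by simp only [hp, sub_self, hS.apply_zero]
  have hpa : S (-(t - a)) (R W) = p a := by
    simp only [hp, neg_sub]
    exact group_comm hskew hS hR _ _
  rw [hI, hIBP, hpa]
  have hGa : G a = 0 := intervalIntegral.integral_same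
  simp only [inner_sub_left, hpt, hGa, zero_smul, sub_zero,
    real_inner_smul_left, intervalIntegral.integral_neg] at hFTC
  rw [hpt]
  have hcomm : ∫ s in a..t, inner ℝ b (q s) * ∫ r in a..s, g r = ∫ s in a..t, G s * inner ℝ b (q s) :=
    intervalIntegral.integral_congr fun s _ => mul_comm _ _
  rw [hcomm]
  change _ - _ - (_ * G t - _) = _
  linarith

end SkewAdjoint

/-! ### Travelling waves -/

/-- Measurable functions on `ℝ` that are square integrable on bounded intervals. -/
structure IsLocL2 (h : ℝ → ℝ) : Prop where
  measurable : Measurable h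
  memLp : ∀ M : ℝ, MemLp h 2 (volume.restrict (Ioo (-M) M))

section Travelling

variable {h : ℝ → ℝ}

theorem measurePreserving_affine {σ : ℝ} (hσ : σ = 1 ∨ σ = -1) (t : ℝ) :
    MeasurePreserving (fun x : ℝ => t + σ * x) volume volume := by
  rcases hσ with rfl | rfl
  · simpa only [one_mul] using measurePreserving_add_left volume t
  · simpa only [neg_one_mul, Function.comp_def] using
      (measurePreserving_add_left volume t).comp (Measure.measurePreserving_neg volume)

theorem IsLocL2.intervalIntegrable (hh : IsLocL2 h) (a b : ℝ) :
    IntervalIntegrable h volume a b := by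
  have h1 : IntegrableOn h (Ioo (-(|a| + |b| + 1)) (|a| + |b| + 1)) :=
    (hh.memLp _).integrable (by norm_num)
  refine (h1.mono_set fun x hx => ?_).intervalIntegrable
  have := abs_le_max_abs_abs hx.1 hx.2
  rw [mem_Ioo, ← abs_lt]
  have h2 : max |min a b| |max a b| ≤ |a| + |b| := by
    refine max_le ?_ ?_
    · exact (abs_min_le_max_abs_abs).trans (max_le_add_of_nonneg (abs_nonneg _) (abs_nonneg _))
    · exact (abs_max_le_max_abs_abs).trans (max_le_add_of_nonneg (abs_nonneg _) (abs_nonneg _))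
  linarith

theorem IsLocL2.intervalIntegrable_add (hh : IsLocL2 h) (c a b : ℝ) :
    IntervalIntegrable (fun s => h (c + s)) volume a b := by
  simpa using (hh.intervalIntegrable (c + a) (c + b)).comp_add_left c

theorem IsLocL2.intervalIntegrable_sub (hh : IsLocL2 h) (c a b : ℝ) :
    IntervalIntegrable (fun s => h (c - s)) volume a b := by
  simpa using (hh.intervalIntegrable (c - a) (c - b)).comp_sub_left c

theorem affine_mem_Ioo {σ : ℝ} (hσ : σ = 1 ∨ σ = -1) {t M x : ℝ} (hM : |t| + ℓ ≤ M)
    (hx : x ∈ Ioo 0 ℓ) : t + σ * x ∈ Ioo (-M) M := by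
  have h1 := neg_abs_le t
  have h2 := le_abs_self t
  obtain ⟨h3, h4⟩ := hx
  rcases hσ with rfl | rfl <;> constructor <;> linarith

theorem IsLocL2.memLp_indicator (hh : IsLocL2 h) (M : ℝ) :
    MemLp ((Ioo (-M) M).indicator h) 2 volume :=
  (memLp_indicator_iff_restrict measurableSet_Ioo).2 (hh.memLp M)

theorem IsLocL2.memLp_affine (hh : IsLocL2 h) {σ : ℝ} (hσ : σ = 1 ∨ σ = -1) (t : ℝ) :
    MemLp (fun x => h (t + σ * x)) 2 (volume.restrict (Ioo 0 ℓ)) := by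
  have h1 := ((hh.memLp_indicator (|t| + ℓ)).comp_measurePreserving
    (measurePreserving_affine hσ t)).restrict (Ioo 0 ℓ)
  refine h1.ae_eq ?_
  filter_upwards [ae_restrict_mem measurableSet_Ioo] with x hx
  exact indicator_of_mem (affine_mem_Ioo hσ le_rfl hx) h

/-- The function `x ↦ h(t + σ x)` on `(0, ℓ)`. -/
def slice (ℓ : ℝ) (h : ℝ → ℝ) (σ t : ℝ) : V ℓ := toV ℓ fun x => h (t + σ * x)

theorem coeFn_slice (hh : IsLocL2 h) {σ : ℝ} (hσ : σ = 1 ∨ σ = -1) (t : ℝ) :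
    slice ℓ h σ t =ᵐ[volume.restrict (Ioo 0 ℓ)] fun x => h (t + σ * x) :=
  coeFn_toV (hh.memLp_affine hσ t)

/-- This is continuity of translations in L²(ℝ). The cut-off of h to (-M, M) is invisible on (0, ℓ)
for |t - t₀| < 1, by the choice of M. -/
theorem continuous_slice (hh : IsLocL2 h) {σ : ℝ} (hσ : σ = 1 ∨ σ = -1) :
    Continuous (slice ℓ h σ) := by
  refine continuous_iff_continuousAt.2 fun t₀ => ?_
  set M : ℝ := |t₀| + 1 + ℓ
  let f : ℝ → C(ℝ, ℝ) := fun t => ⟨fun x => t + σ * x, by fun_prop⟩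
  have hf : Continuous f := by
    refine ContinuousMap.continuous_of_continuous_uncurry _ ?_
    change Continuous fun p : ℝ × ℝ => p.1 + σ * p.2
    fun_prop
  let k : Lp ℝ 2 (volume : Measure ℝ) := (hh.memLp_indicator M).toLp
  have hc := (continuous_const (y := k)).compMeasurePreservingLp hf
    (fun t => measurePreserving_affine hσ t) (by norm_num)
  have hc2 := ((LpToLpRestrictCLM ℝ ℝ ℝ volume 2 (Ioo 0 ℓ)).continuous.comp hc).continuousAt
    (x := t₀)
  refine hc2.congr ?_
  filter_upwards [Metric.ball_mem_nhds t₀ one_pos] with t ht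
  rw [Real.ball_eq_Ioo] at ht
  have htM : |t| + ℓ ≤ M := by
    have : |t| ≤ |t₀| + 1 := by
      have h1 := abs_le.1 (le_refl |t₀|)
      rw [abs_le]
      constructor <;> linarith [ht.1, ht.2]
    simp only [M]
    linarith
  refine Lp.ext ?_
  refine (LpToLpRestrictCLM_coeFn ℝ (Ioo 0 ℓ) _).trans ?_
  refine Filter.EventuallyEq.trans ?_ (coeFn_slice hh hσ t).symm
  have h1 := ae_restrict_of_ae (s := Ioo 0 ℓ)
    (Lp.coeFn_compMeasurePreserving k (measurePreserving_affine hσ t))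
  have h2 := ae_restrict_of_ae (s := Ioo 0 ℓ)
    ((measurePreserving_affine hσ t).quasiMeasurePreserving.ae (hh.memLp_indicator M).coeFn_toLp)
  filter_upwards [h1, h2, ae_restrict_mem measurableSet_Ioo] with x hx1 hx2 hxm
  refine hx1.trans (hx2.trans ?_)
  exact indicator_of_mem (affine_mem_Ioo hσ htM hxm) h

theorem IsLocL2.of_continuous (hc : Continuous h) : IsLocL2 h := by
  refine ⟨hc.measurable, fun M => ?_⟩
  obtain ⟨C, hC⟩ := (isCompact_Icc (a := -M) (b := M)).exists_bound_of_continuousOn hc.continuousOn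
  refine MemLp.of_bound hc.aestronglyMeasurable C ?_
  filter_upwards [ae_restrict_mem measurableSet_Ioo] with x hx
  exact hC x (Ioo_subset_Icc_self hx)

/-- The primitive of `h` vanishing at `0`. -/
def primitive (h : ℝ → ℝ) (x : ℝ) : ℝ := ∫ s in (0 : ℝ)..x, h s

theorem IsLocL2.continuous_primitive (hh : IsLocL2 h) : Continuous (primitive h) :=
  intervalIntegral.continuous_primitive hh.intervalIntegrable 0

theorem IsLocL2.integral_eq (hh : IsLocL2 h) (a b : ℝ) :
    ∫ s in a..b, h s = primitive h b - primitive h a :=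
  (intervalIntegral.integral_interval_sub_left (hh.intervalIntegrable _ _)
    (hh.intervalIntegrable _ _)).symm

/-- Integrability for Fubini: by Cauchy–Schwarz the inner integral of the absolute value is at most
the norm of the slice times ‖ψ‖, and the slices are bounded for s in a compact interval. -/
theorem integrable_slice_mul (hℓ : 0 < ℓ) (hh : IsLocL2 h) {σ : ℝ} (hσ : σ = 1 ∨ σ = -1) (t : ℝ)
    (ψ : V ℓ) : Integrable (Function.uncurry fun s x => h (s + σ * x) * ψ x)
      ((volume.restrict (uIoc 0 t)).prod (volume.restrict (Ioo 0 ℓ))) := by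
  have hm : Measurable (Function.uncurry fun s x => h (s + σ * x) * ψ x) :=
    (hh.measurable.comp (measurable_fst.add (measurable_snd.const_mul σ))).mul
      ((Lp.stronglyMeasurable ψ).measurable.comp measurable_snd)
  have : IsFiniteMeasure (volume.restrict (uIoc 0 t)) := by
    unfold uIoc
    infer_instance
  rw [integrable_prod_iff hm.aestronglyMeasurable]
  refine ⟨Filter.Eventually.of_forall fun s =>
    (hh.memLp_affine hσ s).integrable_mul (Lp.memLp ψ), ?_⟩
  obtain ⟨C, hC⟩ := (isCompact_uIcc (a := 0) (b := t)).exists_bound_of_continuousOn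
    (continuous_slice (ℓ := ℓ) hh hσ).continuousOn
  refine Integrable.of_bound hm.norm.stronglyMeasurable.integral_prod_right.aestronglyMeasurable
    (C * ‖ψ‖) ?_
  filter_upwards [ae_restrict_mem measurableSet_uIoc] with s hs
  rw [Real.norm_of_nonneg (integral_nonneg fun _ => norm_nonneg _)]
  refine le_trans ?_ (mul_le_mul_of_nonneg_right (hC s (uIoc_subset_uIcc hs)) (norm_nonneg ψ))
  have hab : ∀ f : V ℓ, toV ℓ (fun x => |f x|) =ᵐ[volume.restrict (Ioo 0 ℓ)] fun x => |f x| :=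
    fun f => coeFn_toV (Lp.memLp f).abs
  have hn : ∀ f : V ℓ, ‖toV ℓ (fun x => |f x|)‖ ≤ ‖f‖ := fun f => by
    refine Lp.norm_le_norm_of_ae_le ?_
    filter_upwards [hab f] with x hx
    rw [hx]; simp
  refine le_trans (le_of_eq ?_) ((real_inner_le_norm (toV ℓ fun x => |slice ℓ h σ s x|)
    (toV ℓ fun x => |ψ x|)).trans
      (mul_le_mul (hn _) (hn _) (norm_nonneg _) (norm_nonneg _)))
  rw [inner_V_eq hℓ, ← setIntegral_Ioo_eq hℓ]
  refine integral_congr_ae ?_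
  filter_upwards [hab (slice ℓ h σ s), hab ψ,
    coeFn_slice (ℓ := ℓ) hh hσ s] with x h1 h2 h3
  rw [h1, h2, h3]
  simp

/-- The slices of a primitive are the integrals of the slices. -/
theorem slice_primitive (hℓ : 0 < ℓ) (hh : IsLocL2 h) {σ : ℝ} (hσ : σ = 1 ∨ σ = -1) (t : ℝ) :
    slice ℓ (primitive h) σ t =
      slice ℓ (primitive h) σ 0 + ∫ s in (0 : ℝ)..t, slice ℓ h σ s := by
  have hH := IsLocL2.of_continuous hh.continuous_primitive
  have hi : IntervalIntegrable (slice ℓ h σ) volume 0 t :=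
    (continuous_slice hh hσ).intervalIntegrable _ _
  rw [← sub_eq_iff_eq_add']
  -- Testing against ψ turns the Bochner integral into a double integral, to which Fubini applies.
  refine ext_inner_left ℝ fun ψ => ?_
  rw [← innerSL_apply_apply ℝ ψ (∫ s in (0 : ℝ)..t, slice ℓ h σ s),
    ← ContinuousLinearMap.intervalIntegral_comp_comm _ hi]
  have e1 : ∀ s, innerSL ℝ ψ (slice ℓ h σ s) = ∫ x in Ioo 0 ℓ, h (s + σ * x) * ψ x := fun s => by
    rw [innerSL_apply_apply, inner_V_eq hℓ, ← setIntegral_Ioo_eq hℓ]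
    refine integral_congr_ae ?_
    filter_upwards [coeFn_slice (ℓ := ℓ) hh hσ s] with x hx
    rw [hx, mul_comm]
  simp only [e1]
  have e2 : ∫ s in (0 : ℝ)..t, ∫ x in Ioo 0 ℓ, h (s + σ * x) * ψ x =
      ∫ x in Ioo 0 ℓ, ∫ s in (0 : ℝ)..t, h (s + σ * x) * ψ x := by
    simp only [intervalIntegral.intervalIntegral_eq_integral_uIoc]
    rw [integral_integral_swap (integrable_slice_mul hℓ hh hσ t ψ), integral_smul]
  rw [e2, inner_V_eq hℓ, ← setIntegral_Ioo_eq hℓ]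
  refine integral_congr_ae ?_
  filter_upwards [coeFn_slice (ℓ := ℓ) hH hσ t, coeFn_slice (ℓ := ℓ) hH hσ 0,
    Lp.coeFn_sub (slice ℓ (primitive h) σ t) (slice ℓ (primitive h) σ 0)] with x h1 h2 h3
  rw [h3, Pi.sub_apply, h1, h2, intervalIntegral.integral_mul_const,
    intervalIntegral.integral_comp_add_right (fun s => h s), hh.integral_eq]
  ring

/-- The wave `(y, y_t)` with Riemann invariants `y_x ± y_t = h(t ± x)`. -/
def wave (hℓ : 0 < ℓ) (h : ℝ → ℝ) (t : ℝ) : Energy ℓ :=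
  WithLp.toLp 2 (prim hℓ ((1 / 2 : ℝ) • (slice ℓ h 1 t + slice ℓ h (-1) t)),
    (1 / 2 : ℝ) • (slice ℓ h 1 t - slice ℓ h (-1) t))

theorem dx_wave_fst (hℓ : 0 < ℓ) (h : ℝ → ℝ) (t : ℝ) :
    dx ℓ (wave hℓ h t).fst = (1 / 2 : ℝ) • (slice ℓ h 1 t + slice ℓ h (-1) t) := dx_prim hℓ _

theorem wave_snd (hℓ : 0 < ℓ) (h : ℝ → ℝ) (t : ℝ) :
    (wave hℓ h t).snd = (1 / 2 : ℝ) • (slice ℓ h 1 t - slice ℓ h (-1) t) := rfl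

theorem integral_dx_wave_fst (hℓ : 0 < ℓ) (hh : IsLocL2 h) (t : ℝ) {x : ℝ} (hx : x ∈ Icc 0 ℓ) :
    ∫ s in (0 : ℝ)..x, dx ℓ (wave hℓ h t).fst s =
      1 / 2 * (primitive h (t + x) - primitive h (t - x)) := by
  have hae : dx ℓ (wave hℓ h t).fst =ᵐ[volume.restrict (Ioo 0 ℓ)]
      fun s => 1 / 2 * (h (t + s) + h (t - s)) := by
    rw [dx_wave_fst]
    filter_upwards [Lp.coeFn_smul (1 / 2 : ℝ) (slice ℓ h 1 t + slice ℓ h (-1) t),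
      Lp.coeFn_add (slice ℓ h 1 t) (slice ℓ h (-1) t), coeFn_slice (ℓ := ℓ) hh (Or.inl rfl) t,
      coeFn_slice (ℓ := ℓ) hh (Or.inr rfl) t] with s h1 h2 h3 h4
    rw [h1, Pi.smul_apply, h2, Pi.add_apply, h3, h4, one_mul, neg_one_mul, ← sub_eq_add_neg,
      smul_eq_mul]
  rw [integral_congr_V hae (left_mem_Icc.2 hℓ.le) hx, intervalIntegral.integral_const_mul,
    intervalIntegral.integral_add (hh.intervalIntegrable_add t _ _)
      (hh.intervalIntegrable_sub t _ _),
    intervalIntegral.integral_comp_add_left (fun s => h s),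
    intervalIntegral.integral_comp_sub_left (fun s => h s), hh.integral_eq, hh.integral_eq,
    add_zero, sub_zero]
  ring

theorem integral_wave_snd (hℓ : 0 < ℓ) (hh : IsLocL2 h) (t : ℝ) {x : ℝ} (hx : x ∈ Icc 0 ℓ) :
    ∫ s in (0 : ℝ)..x, (wave hℓ h t).snd s =
      1 / 2 * (primitive h (t + x) + primitive h (t - x)) - primitive h t := by
  have hae : (wave hℓ h t).snd =ᵐ[volume.restrict (Ioo 0 ℓ)]
      fun s => 1 / 2 * (h (t + s) - h (t - s)) := by
    rw [wave_snd]
    filter_upwards [Lp.coeFn_smul (1 / 2 : ℝ) (slice ℓ h 1 t - slice ℓ h (-1) t),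
      Lp.coeFn_sub (slice ℓ h 1 t) (slice ℓ h (-1) t), coeFn_slice (ℓ := ℓ) hh (Or.inl rfl) t,
      coeFn_slice (ℓ := ℓ) hh (Or.inr rfl) t] with s h1 h2 h3 h4
    rw [h1, Pi.smul_apply, h2, Pi.sub_apply, h3, h4, one_mul, neg_one_mul, ← sub_eq_add_neg,
      smul_eq_mul]
  rw [integral_congr_V hae (left_mem_Icc.2 hℓ.le) hx, intervalIntegral.integral_const_mul,
    intervalIntegral.integral_sub (hh.intervalIntegrable_add t _ _)
      (hh.intervalIntegrable_sub t _ _),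
    intervalIntegral.integral_comp_add_left (fun s => h s),
    intervalIntegral.integral_comp_sub_left (fun s => h s), hh.integral_eq, hh.integral_eq,
    add_zero, sub_zero]
  ring

theorem dirac_wave (hℓ : 0 < ℓ) (hh : IsLocL2 h) (t : ℝ) :
    dirac hℓ (wave hℓ h t).fst = 1 / 2 * (primitive h (t + ℓ) - primitive h (t - ℓ)) := by
  rw [dirac_apply, integral_dx_wave_fst hℓ hh t (right_mem_Icc.2 hℓ.le)]

theorem invWave_wave_snd (hℓ : 0 < ℓ) (hh : IsLocL2 h) (t : ℝ) :
    (invWave hℓ (wave hℓ h t)).snd =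
      (1 / 2 : ℝ) • (slice ℓ (primitive h) 1 t - slice ℓ (primitive h) (-1) t) := by
  have hH := IsLocL2.of_continuous hh.continuous_primitive
  rw [invWave_snd]
  refine Lp.ext ?_
  filter_upwards [coeFn_incl hℓ (wave hℓ h t).fst, ae_restrict_mem measurableSet_Ioo,
    Lp.coeFn_smul (1 / 2 : ℝ) (slice ℓ (primitive h) 1 t - slice ℓ (primitive h) (-1) t),
    Lp.coeFn_sub (slice ℓ (primitive h) 1 t) (slice ℓ (primitive h) (-1) t),
    coeFn_slice (ℓ := ℓ) hH (Or.inl rfl) t,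
    coeFn_slice (ℓ := ℓ) hH (Or.inr rfl) t] with x hx hxm h1 h2 h3 h4
  rw [hx, integral_dx_wave_fst hℓ hh t (Ioo_subset_Icc_self hxm), h1, Pi.smul_apply, h2,
    Pi.sub_apply, h3, h4, one_mul, neg_one_mul, ← sub_eq_add_neg, smul_eq_mul]

/-- Up to a constant in x, R replaces h by its primitive. The constant enforces the Neumann
condition at ℓ on the range of R; its variation in t produces the boundary datum. -/
theorem dx_invWave_wave_fst (hℓ : 0 < ℓ) (hh : IsLocL2 h) (t : ℝ) :
    dx ℓ (invWave hℓ (wave hℓ h t)).fst =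
      (1 / 2 : ℝ) • (slice ℓ (primitive h) 1 t + slice ℓ (primitive h) (-1) t) -
        (1 / 2 * (primitive h (t + ℓ) + primitive h (t - ℓ))) • toV ℓ fun _ => 1 := by
  have hH := IsLocL2.of_continuous hh.continuous_primitive
  rw [invWave_fst, map_neg]
  refine Lp.ext ?_
  filter_upwards [Lp.coeFn_neg (dx ℓ (invA hℓ (wave hℓ h t).snd)),
    coeFn_dx_invA hℓ (wave hℓ h t).snd, ae_restrict_mem measurableSet_Ioo,
    Lp.coeFn_sub ((1 / 2 : ℝ) • (slice ℓ (primitive h) 1 t + slice ℓ (primitive h) (-1) t))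
      ((1 / 2 * (primitive h (t + ℓ) + primitive h (t - ℓ))) • toV ℓ fun _ => 1),
    Lp.coeFn_smul (1 / 2 * (primitive h (t + ℓ) + primitive h (t - ℓ))) (toV ℓ fun _ => 1),
    coeFn_toV (ℓ := ℓ) (memLp_const (1 : ℝ)),
    Lp.coeFn_smul (1 / 2 : ℝ) (slice ℓ (primitive h) 1 t + slice ℓ (primitive h) (-1) t),
    Lp.coeFn_add (slice ℓ (primitive h) 1 t) (slice ℓ (primitive h) (-1) t),
    coeFn_slice (ℓ := ℓ) hH (Or.inl rfl) t,
    coeFn_slice (ℓ := ℓ) hH (Or.inr rfl) t] with x k1 k2 hxm k3 k4 k5 h1 h2 h3 h4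
  have hxm' := Ioo_subset_Icc_self hxm
  rw [k1, Pi.neg_apply, k2, integral_congr_V (Lp.coeFn_neg _) (left_mem_Icc.2 hℓ.le) hxm']
  simp only [Pi.neg_apply, intervalIntegral.integral_neg]
  rw [integral_wave_snd hℓ hh t hxm', integral_wave_snd hℓ hh t (right_mem_Icc.2 hℓ.le), k3,
    Pi.sub_apply, k4, Pi.smul_apply, k5, h1, Pi.smul_apply, h2,
    Pi.add_apply, h3, h4, one_mul, neg_one_mul, ← sub_eq_add_neg, smul_eq_mul, smul_eq_mul]
  ring_nf

theorem continuous_wave (hℓ : 0 < ℓ) (hh : IsLocL2 h) : Continuous (wave hℓ h) := by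
  have h1 := continuous_slice (ℓ := ℓ) hh (Or.inl rfl)
  have h2 := continuous_slice (ℓ := ℓ) hh (Or.inr rfl)
  refine (WithLp.prod_continuous_toLp 2 _ _).comp
    (Continuous.prodMk ?_ ((h1.sub h2).const_smul (1 / 2 : ℝ)))
  refine (dx ℓ).isometry.isEmbedding.continuous_iff.2 ?_
  have : (dx ℓ ∘ fun t => prim hℓ ((1 / 2 : ℝ) • (slice ℓ h 1 t + slice ℓ h (-1) t))) =
      fun t => (1 / 2 : ℝ) • (slice ℓ h 1 t + slice ℓ h (-1) t) :=
    funext fun t => dx_prim hℓ _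
  rw [this]
  exact (h1.add h2).const_smul (1 / 2 : ℝ)

/-- A travelling wave is an integrated solution of the wave equation with the Neumann datum
`(h(t + ℓ) + h(t - ℓ)) / 2` at `ℓ`. -/
theorem invWave_wave (hℓ : 0 < ℓ) (hh : IsLocL2 h) (t : ℝ) :
    invWave hℓ (wave hℓ h t) = invWave hℓ (wave hℓ h 0) + (∫ s in (0 : ℝ)..t, wave hℓ h s) +
      (∫ s in (0 : ℝ)..t, 1 / 2 * (h (s + ℓ) + h (s - ℓ))) • invDirac hℓ := by
  have := completeSpace_VHalf hℓ
  have hi : IntervalIntegrable (wave hℓ h) volume 0 t :=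
    (continuous_wave hℓ hh).intervalIntegrable _ _
  have hi1 : IntervalIntegrable (slice ℓ h 1) volume 0 t :=
    (continuous_slice hh (Or.inl rfl)).intervalIntegrable _ _
  have hi2 : IntervalIntegrable (slice ℓ h (-1)) volume 0 t :=
    (continuous_slice hh (Or.inr rfl)).intervalIntegrable _ _
  have eg : ∫ s in (0 : ℝ)..t, 1 / 2 * (h (s + ℓ) + h (s - ℓ)) =
      1 / 2 * (primitive h (t + ℓ) + primitive h (t - ℓ)) -
        1 / 2 * (primitive h (0 + ℓ) + primitive h (0 - ℓ)) := by
    rw [intervalIntegral.integral_const_mul, intervalIntegral.integral_add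
        (by simpa only [add_comm] using hh.intervalIntegrable_add ℓ 0 t)
        (by simpa only [sub_eq_neg_add] using hh.intervalIntegrable_add (-ℓ) 0 t),
      intervalIntegral.integral_comp_add_right (fun s => h s),
      intervalIntegral.integral_comp_sub_right (fun s => h s), hh.integral_eq, hh.integral_eq]
    ring
  have es : (∫ s in (0 : ℝ)..t, wave hℓ h s).snd =
      (1 / 2 : ℝ) • ((∫ s in (0 : ℝ)..t, slice ℓ h 1 s) - ∫ s in (0 : ℝ)..t, slice ℓ h (-1) s) := by
    have := (WithLp.sndL 2 ℝ (VHalf ℓ) (V ℓ)).intervalIntegral_comp_comm hi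
    rw [← intervalIntegral.integral_sub hi1 hi2, ← intervalIntegral.integral_smul]
    exact this.symm
  have ef : dx ℓ (∫ s in (0 : ℝ)..t, wave hℓ h s).fst =
      (1 / 2 : ℝ) • ((∫ s in (0 : ℝ)..t, slice ℓ h 1 s) + ∫ s in (0 : ℝ)..t, slice ℓ h (-1) s) := by
    have := ((dx ℓ).toContinuousLinearMap.comp
      (WithLp.fstL 2 ℝ (VHalf ℓ) (V ℓ))).intervalIntegral_comp_comm hi
    rw [← intervalIntegral.integral_add hi1 hi2, ← intervalIntegral.integral_smul]
    refine Eq.trans this.symm (intervalIntegral.integral_congr fun s _ => ?_)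
    exact dx_wave_fst hℓ h s
  have eb : dx ℓ (invDirac hℓ).fst = -toV ℓ fun _ => 1 := by
    change dx ℓ (-prim hℓ _) = _
    rw [map_neg, dx_prim]
  have eb2 : (invDirac hℓ).snd = 0 := rfl
  refine energy_ext ((dx ℓ).injective ?_) ?_
  · rw [WithLp.add_fst, WithLp.add_fst, WithLp.smul_fst, map_add, map_add, map_smul, ef, eb,
      dx_invWave_wave_fst hℓ hh, dx_invWave_wave_fst hℓ hh, eg,
      slice_primitive hℓ hh (Or.inl rfl) t, slice_primitive hℓ hh (Or.inr rfl) t]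
    module
  · rw [WithLp.add_snd, WithLp.add_snd, WithLp.smul_snd, es, eb2,
      invWave_wave_snd hℓ hh, invWave_wave_snd hℓ hh,
      slice_primitive hℓ hh (Or.inl rfl) t, slice_primitive hℓ hh (Or.inr rfl) t]
    module

/-- The parallelogram law splits the energy between the two invariants, so pointwise bounds on h
give energy bounds. -/
theorem norm_wave_sq (hℓ : 0 < ℓ) (h : ℝ → ℝ) (t : ℝ) :
    ‖wave hℓ h t‖ ^ 2 = 1 / 2 * (‖slice ℓ h 1 t‖ ^ 2 + ‖slice ℓ h (-1) t‖ ^ 2) := by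
  have e : ‖(wave hℓ h t).fst‖ = ‖dx ℓ (wave hℓ h t).fst‖ := ((dx ℓ).norm_map _).symm
  have p := parallelogram_law_with_norm ℝ (slice ℓ h 1 t) (slice ℓ h (-1) t)
  rw [WithLp.prod_norm_sq_eq_of_L2, e, dx_wave_fst, wave_snd, norm_smul, norm_smul]
  norm_num
  linarith

end Travelling

/-! ### Extension of the initial data by scalar multiples -/

/-- The function on `ℝ` that equals `a n • k(· - 2nℓ)` on `[(2n - 1)ℓ, (2n + 1)ℓ)`. -/
def scaledExt (ℓ : ℝ) (a : ℤ → ℝ) (k : ℝ → ℝ) (x : ℝ) : ℝ :=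
  a ⌊(x + ℓ) / (2 * ℓ)⌋ * k (x - 2 * ℓ * ⌊(x + ℓ) / (2 * ℓ)⌋)

/-- Together with `scaledExt_add`, this writes the values at s ± ℓ as consecutive coefficients times
the same value of k. Boundary conditions at ℓ thereby become recursions for `a`. -/
theorem scaledExt_sub (a : ℤ → ℝ) (k : ℝ → ℝ) (s : ℝ) :
    scaledExt ℓ a k (s - ℓ) = a ⌊s / (2 * ℓ)⌋ * k (s - ℓ - 2 * ℓ * ⌊s / (2 * ℓ)⌋) := by
  rw [scaledExt, sub_add_cancel]

theorem floor_add_period (hℓ : 0 < ℓ) (s : ℝ) :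
    ⌊(s + ℓ + ℓ) / (2 * ℓ)⌋ = ⌊s / (2 * ℓ)⌋ + 1 := by
  rw [← Int.floor_add_one]
  congr 1
  field_simp
  ring

theorem scaledExt_add (hℓ : 0 < ℓ) (a : ℤ → ℝ) (k : ℝ → ℝ) (s : ℝ) :
    scaledExt ℓ a k (s + ℓ) = a (⌊s / (2 * ℓ)⌋ + 1) * k (s - ℓ - 2 * ℓ * ⌊s / (2 * ℓ)⌋) := by
  rw [scaledExt, floor_add_period hℓ]
  congr 2
  push_cast
  ring

theorem scaledExt_of_mem (hℓ : 0 < ℓ) (a : ℤ → ℝ) (k : ℝ → ℝ) {x : ℝ} (hx : x ∈ Ico (-ℓ) ℓ) :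
    scaledExt ℓ a k x = a 0 * k x := by
  have : ⌊(x + ℓ) / (2 * ℓ)⌋ = 0 := by
    rw [Int.floor_eq_zero_iff]
    refine ⟨div_nonneg (by linarith [hx.1]) (by linarith), ?_⟩
    rw [div_lt_one (by linarith)]
    linarith [hx.2]
  rw [scaledExt, this]
  simp

theorem measurable_scaledExt (a : ℤ → ℝ) {k : ℝ → ℝ} (hk : Measurable k) :
    Measurable (scaledExt ℓ a k) := by
  have hf : Measurable fun x : ℝ => ⌊(x + ℓ) / (2 * ℓ)⌋ :=
    ((measurable_id.add_const ℓ).div_const (2 * ℓ)).floor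
  have hc : Measurable fun x : ℝ => ((⌊(x + ℓ) / (2 * ℓ)⌋ : ℤ) : ℝ) :=
    (measurable_from_top (f := fun n : ℤ => (n : ℝ))).comp hf
  exact ((measurable_from_top (f := a)).comp hf).mul
    (hk.comp (measurable_id.sub (hc.const_mul (2 * ℓ))))

theorem scaledExt_one_periodic (hℓ : 0 < ℓ) (k : ℝ → ℝ) :
    Function.Periodic (scaledExt ℓ (fun _ => 1) k) (2 * ℓ) := by
  intro x
  have h1 := scaledExt_add hℓ (fun _ => 1) k (x + ℓ)
  have h2 := scaledExt_sub (ℓ := ℓ) (fun _ => 1) k (x + ℓ)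
  rw [add_sub_cancel_right] at h2
  have e : x + 2 * ℓ = x + ℓ + ℓ := by ring
  rw [h2, e, h1, add_sub_cancel_right]

/-- On bounded intervals, two extensions with nonvanishing reference coefficients are comparable. -/
theorem exists_scaledExt_le (hℓ : 0 < ℓ) (a a' : ℤ → ℝ) (ha' : ∀ n, |a' n| = 1) (M : ℝ) :
    ∃ C : ℝ, 0 ≤ C ∧ ∀ (k : ℝ → ℝ), ∀ x ∈ Ioo (-M) M,
      |scaledExt ℓ a k x| ≤ C * |scaledExt ℓ a' k x| := by
  -- Only finitely many windows meet (-M, M), so the coefficients occurring there are bounded.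
  obtain ⟨C, hC⟩ := ((finite_Icc ⌊(-M + ℓ) / (2 * ℓ)⌋ ⌊(M + ℓ) / (2 * ℓ)⌋).image
    fun n => |a n|).bddAbove
  refine ⟨max C 0, le_max_right _ _, fun k x hx => ?_⟩
  have h2 : 0 < 2 * ℓ := by linarith
  have hm : |a ⌊(x + ℓ) / (2 * ℓ)⌋| ≤ max C 0 := le_max_of_le_left <| hC <| mem_image_of_mem _
    ⟨Int.floor_mono (by gcongr; exact hx.1.le), Int.floor_mono (by gcongr; exact hx.2.le)⟩
  rw [scaledExt, scaledExt, abs_mul, abs_mul, ha', one_mul]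
  gcongr

/-- With all coefficients equal to 1 the extension is periodic, hence locally square integrable;
other coefficients are handled by comparison on bounded intervals. -/
theorem isLocL2_scaledExt (hℓ : 0 < ℓ) (a : ℤ → ℝ) {k : ℝ → ℝ} (hk : Measurable k)
    (hk2 : IntervalIntegrable (fun x => k x ^ 2) volume (-ℓ) ℓ) : IsLocL2 (scaledExt ℓ a k) := by
  refine ⟨measurable_scaledExt a hk, fun M => ?_⟩
  set p := scaledExt ℓ (fun _ => 1) k with hp
  have hper : Function.Periodic (fun x => p x ^ 2) (2 * ℓ) := fun x => by
    simp only [hp, scaledExt_one_periodic hℓ k x]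
  have hpi : IntervalIntegrable (fun x => p x ^ 2) volume (-ℓ) (-ℓ + 2 * ℓ) := by
    have e : -ℓ + 2 * ℓ = ℓ := by ring
    rw [e, intervalIntegrable_iff_integrableOn_Ico_of_le (by linarith)]
    rw [intervalIntegrable_iff_integrableOn_Ico_of_le (by linarith)] at hk2
    refine hk2.congr_fun (fun x hx => ?_) measurableSet_Ico
    simp only [hp, scaledExt_of_mem hℓ _ k hx, one_mul]
  have hpM : MemLp p 2 (volume.restrict (Ioo (-M) M)) := by
    rw [memLp_two_iff_integrable_sq (measurable_scaledExt _ hk).aestronglyMeasurable]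
    rcases le_or_gt (-M) M with hM | hM
    · exact (intervalIntegrable_iff_integrableOn_Ioo_of_le hM).1
        (hper.intervalIntegrable (by linarith) hpi _ _)
    · rw [Ioo_eq_empty (by linarith)]
      simp
  obtain ⟨C, -, hC⟩ := exists_scaledExt_le hℓ a (fun _ => 1) (fun _ => abs_one) M
  refine hpM.of_le_mul (c := C) (measurable_scaledExt a hk).aestronglyMeasurable ?_
  filter_upwards [ae_restrict_mem measurableSet_Ioo] with x hx
  exact hC k x hx

/-- The Riemann invariants of `U`, glued to a function on `(-ℓ, ℓ)`: `y_x + z` at `x > 0`, and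
`y_x - z` reflected at `x < 0`. -/
def invariants (U : Energy ℓ) (x : ℝ) : ℝ :=
  if 0 < x then dx ℓ U.fst x + U.snd x else dx ℓ U.fst (-x) - U.snd (-x)

theorem measurable_invariants (U : Energy ℓ) : Measurable (invariants U) := by
  have h1 := (Lp.stronglyMeasurable (dx ℓ U.fst)).measurable
  have h2 := (Lp.stronglyMeasurable U.snd).measurable
  exact Measurable.ite measurableSet_Ioi (h1.add h2)
    ((h1.comp measurable_neg).sub (h2.comp measurable_neg))

theorem intervalIntegrable_sq_invariants (hℓ : 0 < ℓ) (U : Energy ℓ) :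
    IntervalIntegrable (fun x => invariants U x ^ 2) volume (-ℓ) ℓ := by
  have h1 : IntervalIntegrable (fun x => (dx ℓ U.fst x + U.snd x) ^ 2) volume 0 ℓ :=
    (intervalIntegrable_iff_integrableOn_Ioo_of_le hℓ.le).2
      ((Lp.memLp (dx ℓ U.fst)).add (Lp.memLp U.snd)).integrable_sq
  have h2 : IntervalIntegrable (fun x => (dx ℓ U.fst x - U.snd x) ^ 2) volume 0 ℓ :=
    (intervalIntegrable_iff_integrableOn_Ioo_of_le hℓ.le).2
      ((Lp.memLp (dx ℓ U.fst)).sub (Lp.memLp U.snd)).integrable_sq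
  have h3 := (h2.comp_sub_left 0).symm
  simp only [zero_sub, neg_zero] at h3
  refine IntervalIntegrable.trans (b := 0) (h3.congr fun x hx => ?_) (h1.congr fun x hx => ?_)
  · rw [uIoc_of_le (by linarith)] at hx
    simp only [invariants, if_neg (not_lt.2 hx.2)]
  · rw [uIoc_of_le hℓ.le] at hx
    simp only [invariants, if_pos hx.1]

theorem isLocL2_invariants (hℓ : 0 < ℓ) (a : ℤ → ℝ) (U : Energy ℓ) :
    IsLocL2 (scaledExt ℓ a (invariants U)) :=
  isLocL2_scaledExt hℓ a (measurable_invariants U) (intervalIntegrable_sq_invariants hℓ U)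

theorem wave_scaledExt_zero (hℓ : 0 < ℓ) {a : ℤ → ℝ} (ha : a 0 = 1) (U : Energy ℓ) :
    wave hℓ (scaledExt ℓ a (invariants U)) 0 = U := by
  set h := scaledExt ℓ a (invariants U) with hdef
  have hh : IsLocL2 h := isLocL2_invariants hℓ a U
  have e1 : slice ℓ h 1 0 = dx ℓ U.fst + U.snd := by
    refine Lp.ext ?_
    filter_upwards [coeFn_slice (ℓ := ℓ) hh (Or.inl rfl) 0, Lp.coeFn_add (dx ℓ U.fst) U.snd,
      ae_restrict_mem measurableSet_Ioo] with x h1 h2 hx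
    rw [h1, h2, hdef, scaledExt_of_mem hℓ _ _ ⟨by linarith [hx.1], by linarith [hx.2]⟩, ha,
      zero_add, one_mul, one_mul, invariants, if_pos hx.1, Pi.add_apply]
  have e2 : slice ℓ h (-1) 0 = dx ℓ U.fst - U.snd := by
    refine Lp.ext ?_
    filter_upwards [coeFn_slice (ℓ := ℓ) hh (Or.inr rfl) 0, Lp.coeFn_sub (dx ℓ U.fst) U.snd,
      ae_restrict_mem measurableSet_Ioo] with x h1 h2 hx
    rw [h1, h2, hdef, scaledExt_of_mem hℓ _ _ ⟨by linarith [hx.2], by linarith [hx.1]⟩, ha,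
      zero_add, neg_one_mul, one_mul, invariants, if_neg (by linarith [hx.1]), neg_neg,
      Pi.sub_apply]
  refine energy_ext ((dx ℓ).injective ?_) ?_
  · rw [dx_wave_fst, e1, e2]
    module
  · rw [wave_snd, e1, e2]
    module

/-- The coefficients of the free wave: every reflection at `ℓ` changes the sign. -/
def freeCoeff (n : ℤ) : ℝ := (-1) ^ n

/-- Consecutive coefficients are opposite, so the Neumann datum vanishes identically. -/
theorem isOrbit_freeWave (hℓ : 0 < ℓ) (U : Energy ℓ) :
    IsOrbit (invWave hℓ) (wave hℓ (scaledExt ℓ freeCoeff (invariants U))) := by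
  have hh := isLocL2_invariants hℓ freeCoeff U
  refine ⟨continuous_wave hℓ hh, fun t => ?_⟩
  have h0 : ∀ s, 1 / 2 * (scaledExt ℓ freeCoeff (invariants U) (s + ℓ) +
      scaledExt ℓ freeCoeff (invariants U) (s - ℓ)) = 0 := fun s => by
    rw [scaledExt_add hℓ, scaledExt_sub, freeCoeff, freeCoeff, zpow_add_one₀ (by norm_num)]
    ring
  rw [invWave_wave hℓ hh t]
  simp only [h0, intervalIntegral.integral_zero, zero_smul, add_zero]

/-- The coefficients of the delayed wave. -/
def delayCoeffNat (μ : ℝ) : ℕ → ℝ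
  | 0 => 1
  -- The first reflection at ℓ is free. Afterwards h(s + ℓ) + h(s - ℓ) = μ (h(s - ℓ) - h(s - 3ℓ)),
  -- which gives the recursion.
  | 1 => -1
  | n + 2 => (μ - 1) * delayCoeffNat μ (n + 1) - μ * delayCoeffNat μ n

/-- The coefficients of the delayed wave, extended to `ℤ`. -/
def delayCoeff (μ : ℝ) (n : ℤ) : ℝ := delayCoeffNat μ n.toNat

/-- The velocity trace at `ℓ` of a travelling wave. -/
def waveTrace (ℓ : ℝ) (h : ℝ → ℝ) (t : ℝ) : ℝ := 1 / 2 * (h (t + ℓ) - h (t - ℓ))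

/-- The recursion for the coefficients is the delayed boundary condition window by window. Since s ≥
0, only indices n ≥ 0 occur, so the truncation in `delayCoeff` plays no role. -/
theorem feedback_delayCoeff (hℓ : 0 < ℓ) (μ : ℝ) (k : ℝ → ℝ) {s : ℝ} (hs : 0 ≤ s) :
    feedback ℓ μ (waveTrace ℓ (scaledExt ℓ (delayCoeff μ) k)) s =
      1 / 2 * (scaledExt ℓ (delayCoeff μ) k (s + ℓ) + scaledExt ℓ (delayCoeff μ) k (s - ℓ)) := by
  have h2 : 0 < 2 * ℓ := by linarith
  rw [feedback, scaledExt_add hℓ, scaledExt_sub]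
  split_ifs with h
  · have : ⌊s / (2 * ℓ)⌋ = 0 := by
      rw [Int.floor_eq_zero_iff]
      exact ⟨by positivity, (div_lt_one h2).2 h⟩
    rw [this]
    simp [delayCoeff, delayCoeffNat]
  · have hf : ⌊(s - 2 * ℓ) / (2 * ℓ)⌋ = ⌊s / (2 * ℓ)⌋ - 1 := by
      rw [sub_div, div_self h2.ne', Int.floor_sub_one]
    have h1 : 1 ≤ ⌊s / (2 * ℓ)⌋ := by
      rw [Int.le_floor]
      push_cast
      rw [one_le_div h2]
      linarith
    obtain ⟨n, hn⟩ := Int.eq_ofNat_of_zero_le (sub_nonneg.2 h1)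
    rw [waveTrace, scaledExt_add hℓ, scaledExt_sub, hf, sub_eq_iff_eq_add.1 hn]
    have e1 : delayCoeff μ (n + 1 + 1) = delayCoeffNat μ (n + 2) := rfl
    have e2 : delayCoeff μ (n + 1) = delayCoeffNat μ (n + 1) := rfl
    have e3 : delayCoeff μ n = delayCoeffNat μ n := rfl
    have e4 : delayCoeffNat μ (n + 2) =
      (μ - 1) * delayCoeffNat μ (n + 1) - μ * delayCoeffNat μ n := rfl
    have ea : s - 2 * ℓ - ℓ - 2 * ℓ * ((n + 1 - 1 : ℤ) : ℝ) =
        s - ℓ - 2 * ℓ * ((n + 1 : ℤ) : ℝ) := by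
      push_cast
      ring
    rw [ea, sub_add_cancel, add_sub_cancel_right, e1, e2, e3, e4]
    ring

/-- The wave is compared with the free wave of the same data, whose energy is exactly ‖U‖². For t in
[0, T] the arguments t ± x stay in (-(T + ℓ), T + ℓ), so the comparison constant is independent of
U. -/
theorem exists_norm_wave_le (hℓ : 0 < ℓ) (a : ℤ → ℝ) (T : ℝ) :
    ∃ C : ℝ, ∀ U : Energy ℓ, ∀ t ∈ Icc 0 T,
      ‖wave hℓ (scaledExt ℓ a (invariants U)) t‖ ≤ C * ‖U‖ := by
  obtain ⟨C, hC0, hC⟩ := exists_scaledExt_le hℓ a freeCoeff (fun n => by simp [freeCoeff]) (T + ℓ)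
  refine ⟨C, fun U t ht => ?_⟩
  have hs : ∀ σ : ℝ, σ = 1 ∨ σ = -1 → ‖slice ℓ (scaledExt ℓ a (invariants U)) σ t‖ ≤
      C * ‖slice ℓ (scaledExt ℓ freeCoeff (invariants U)) σ t‖ := fun σ hσ => by
    refine Lp.norm_le_mul_norm_of_ae_le_mul ?_
    filter_upwards [coeFn_slice (ℓ := ℓ) (isLocL2_invariants hℓ a U) hσ t,
      coeFn_slice (ℓ := ℓ) (isLocL2_invariants hℓ freeCoeff U) hσ t,
      ae_restrict_mem measurableSet_Ioo] with x h1 h2 hx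
    rw [h1, h2]
    refine hC _ _ (affine_mem_Ioo hσ ?_ hx)
    rw [abs_of_nonneg ht.1]
    linarith [ht.2]
  have := completeSpace_VHalf hℓ
  have hfree : ‖wave hℓ (scaledExt ℓ freeCoeff (invariants U)) t‖ = ‖U‖ := by
    rw [(isOrbit_freeWave hℓ U).norm_eq (inner_invWave_self hℓ),
      wave_scaledExt_zero hℓ (by simp [freeCoeff])]
  refine le_of_sq_le_sq ?_ (by positivity)
  rw [mul_pow, ← hfree, norm_wave_sq, norm_wave_sq]
  have h1 := pow_le_pow_left₀ (norm_nonneg _) (hs 1 (Or.inl rfl)) 2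
  have h2 := pow_le_pow_left₀ (norm_nonneg _) (hs (-1) (Or.inr rfl)) 2
  rw [mul_pow] at h1 h2
  linarith

/-! ### The extrapolated group -/

/-- The Riesz isomorphism `V_{1/2} ≃ V_{-1/2}`. -/
def riesz (hℓ : 0 < ℓ) : VHalf ℓ ≃L[ℝ] VNegHalf ℓ :=
  haveI := completeSpace_VHalf hℓ
  { toLinearEquiv :=
      { toFun := fun f => InnerProductSpace.toDual ℝ (VHalf ℓ) f
        map_add' := fun f g => map_add _ f g
        map_smul' := fun c f => (InnerProductSpace.toDual ℝ (VHalf ℓ)).map_smulₛₗ c f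
        invFun := (InnerProductSpace.toDual ℝ (VHalf ℓ)).symm
        left_inv := (InnerProductSpace.toDual ℝ (VHalf ℓ)).left_inv
        right_inv := (InnerProductSpace.toDual ℝ (VHalf ℓ)).right_inv }
    continuous_toFun := (InnerProductSpace.toDual ℝ (VHalf ℓ)).continuous
    continuous_invFun := (InnerProductSpace.toDual ℝ (VHalf ℓ)).symm.continuous }

theorem riesz_apply (hℓ : 0 < ℓ) (f φ : VHalf ℓ) : riesz hℓ f φ = inner ℝ f φ := rfl

/-- The extension `(y, z) ↦ (z, -A y)` of the wave operator to an isomorphism from the energy space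
to the extrapolation space. -/
def waveExt (hℓ : 0 < ℓ) : Energy ℓ ≃L[ℝ] Extrapolation ℓ :=
  (WithLp.prodContinuousLinearEquiv 2 ℝ (VHalf ℓ) (V ℓ)).trans
    (((((riesz hℓ).trans (ContinuousLinearEquiv.neg ℝ)).prodCongr
      (ContinuousLinearEquiv.refl ℝ (V ℓ))).trans
        (ContinuousLinearEquiv.prodComm ℝ (VNegHalf ℓ) (V ℓ))).trans
      (WithLp.prodContinuousLinearEquiv 2 ℝ (V ℓ) (VNegHalf ℓ)).symm)

theorem waveExt_apply (hℓ : 0 < ℓ) (U : Energy ℓ) :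
    waveExt hℓ U = WithLp.toLp 2 (U.snd, -riesz hℓ U.fst) := rfl

/-- Identities proved after application of R become identities in the extrapolation space on
applying `waveExt`. -/
theorem waveExt_invWave (hℓ : 0 < ℓ) (U : Energy ℓ) : waveExt hℓ (invWave hℓ U) = embed U := by
  rw [waveExt_apply, invWave_fst, invWave_snd, embed]
  congr 2
  ext φ
  rw [map_neg, neg_neg, riesz_apply, inner_invA]
  rfl

theorem waveExt_invDirac (hℓ : 0 < ℓ) (c : ℝ) :
    waveExt hℓ (c • invDirac hℓ) = WithLp.toLp 2 (0, c • dirac hℓ) := by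
  have h : waveExt hℓ (invDirac hℓ) = WithLp.toLp 2 (0, dirac hℓ) := by
    rw [waveExt_apply]
    congr 2
    ext φ
    change (-riesz hℓ (-prim hℓ _)) φ = _
    rw [map_neg, neg_neg, riesz_apply, inner_prim_one]
  rw [map_smul, h, ← WithLp.toLp_smul, Prod.smul_mk, smul_zero]

/-- The group on the extrapolation space that is conjugate to `S`. -/
def extGroup (hℓ : 0 < ℓ) (S : ℝ → Energy ℓ →L[ℝ] Energy ℓ) (t : ℝ) :
    Extrapolation ℓ →L[ℝ] Extrapolation ℓ :=
  (waveExt hℓ : Energy ℓ →L[ℝ] Extrapolation ℓ).comp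
    ((S t).comp ((waveExt hℓ).symm : Extrapolation ℓ →L[ℝ] Energy ℓ))

theorem extGroup_waveExt (hℓ : 0 < ℓ) (S : ℝ → Energy ℓ →L[ℝ] Energy ℓ) (t : ℝ) (U : Energy ℓ) :
    extGroup hℓ S t (waveExt hℓ U) = waveExt hℓ (S t U) := by
  simp [extGroup]

/-- The group properties pass through the conjugation. The extension property holds because `embed`
is `waveExt` after R and S commutes with R. -/
theorem isExtrapolatedGroup_extGroup (hℓ : 0 < ℓ) {S : ℝ → Energy ℓ →L[ℝ] Energy ℓ}
    (hS : IsC0Group S) (hc : ∀ t U, S t (invWave hℓ U) = invWave hℓ (S t U)) :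
    IsExtrapolatedGroup S (extGroup hℓ S) := by
  refine ⟨⟨?_, fun s t => ?_, fun X => ?_⟩, fun t U => ?_⟩
  · ext1 X
    obtain ⟨U, rfl⟩ := (waveExt hℓ).surjective X
    rw [extGroup_waveExt, hS.apply_zero]
    rfl
  · ext1 X
    obtain ⟨U, rfl⟩ := (waveExt hℓ).surjective X
    rw [ContinuousLinearMap.comp_apply, extGroup_waveExt, extGroup_waveExt, extGroup_waveExt,
      hS.map_add]
    rfl
  · obtain ⟨U, rfl⟩ := (waveExt hℓ).surjective X
    simp only [extGroup_waveExt]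
    exact (waveExt hℓ).continuous.comp (hS.continuous U)
  · rw [← waveExt_invWave hℓ, extGroup_waveExt, hc, waveExt_invWave]

/-! ### Solutions in integrated form -/

/-- The integrated wave equation, in components. -/
theorem invWave_eq_iff (hℓ : 0 < ℓ) {Y : ℝ → Energy ℓ} {t : ℝ}
    (hY : IntervalIntegrable Y volume 0 t) (γ : ℝ) :
    invWave hℓ (Y t) = invWave hℓ (Y 0) + (∫ s in (0 : ℝ)..t, Y s) + γ • invDirac hℓ ↔
      incl ℓ (Y t).fst = incl ℓ (Y 0).fst + ∫ s in (0 : ℝ)..t, (Y s).snd ∧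
      ∀ φ : VHalf ℓ, inner ℝ (Y t).snd (incl ℓ φ) = inner ℝ (Y 0).snd (incl ℓ φ) -
        (∫ s in (0 : ℝ)..t, inner ℝ (dx ℓ (Y s).fst) (dx ℓ φ)) + γ * dirac hℓ φ := by
  have := completeSpace_VHalf hℓ
  have es : (∫ s in (0 : ℝ)..t, Y s).snd = ∫ s in (0 : ℝ)..t, (Y s).snd :=
    ((WithLp.sndL 2 ℝ (VHalf ℓ) (V ℓ)).intervalIntegral_comp_comm hY).symm
  have ef : ∀ φ : VHalf ℓ, inner ℝ φ (∫ s in (0 : ℝ)..t, Y s).fst =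
      ∫ s in (0 : ℝ)..t, inner ℝ (dx ℓ (Y s).fst) (dx ℓ φ) := fun φ => by
    refine Eq.trans (((innerSL ℝ φ).comp
      (WithLp.fstL 2 ℝ (VHalf ℓ) (V ℓ))).intervalIntegral_comp_comm hY).symm
      (intervalIntegral.integral_congr fun s _ => ?_)
    exact (inner_VHalf _ _).trans (real_inner_comm _ _)
  have eb : ∀ φ : VHalf ℓ, inner ℝ φ (invDirac hℓ).fst = -dirac hℓ φ := fun φ => by
    change inner ℝ φ (-prim hℓ _) = _
    rw [inner_neg_right, real_inner_comm, inner_prim_one]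
  have eb2 : (invDirac hℓ).snd = 0 := rfl
  have hf : ∀ φ : VHalf ℓ, inner ℝ φ (invWave hℓ (Y 0) + (∫ s in (0 : ℝ)..t, Y s) +
      γ • invDirac hℓ).fst = -inner ℝ (Y 0).snd (incl ℓ φ) +
        (∫ s in (0 : ℝ)..t, inner ℝ (dx ℓ (Y s).fst) (dx ℓ φ)) - γ * dirac hℓ φ := fun φ => by
    rw [WithLp.add_fst, WithLp.add_fst, WithLp.smul_fst, inner_add_right, inner_add_right,
      real_inner_smul_right, ef, eb, invWave_fst, inner_neg_right, real_inner_comm, inner_invA]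
    ring
  have hl : ∀ φ : VHalf ℓ, inner ℝ φ (invWave hℓ (Y t)).fst = -inner ℝ (Y t).snd (incl ℓ φ) :=
    fun φ => by rw [invWave_fst, inner_neg_right, real_inner_comm, inner_invA]
  have hs : (invWave hℓ (Y 0) + (∫ s in (0 : ℝ)..t, Y s) + γ • invDirac hℓ).snd =
      incl ℓ (Y 0).fst + ∫ s in (0 : ℝ)..t, (Y s).snd := by
    rw [WithLp.add_snd, WithLp.add_snd, WithLp.smul_snd, eb2, smul_zero, add_zero, es, invWave_snd]
  constructor
  · intro h
    refine ⟨by rw [← hs, ← h, invWave_snd], fun φ => ?_⟩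
    have := hl φ
    rw [h, hf] at this
    linarith
  · rintro ⟨h1, h2⟩
    refine energy_ext (ext_inner_left ℝ fun φ => ?_) (by rw [hs, ← h1, invWave_snd])
    rw [hl, hf, h2]
    ring

theorem intervalIntegrable_feedback (μ : ℝ) {w : ℝ → ℝ}
    (hw : ∀ T : ℝ, MemLp w 2 (volume.restrict (Ioo 0 T))) {t : ℝ} (ht : 0 ≤ t) :
    IntervalIntegrable (feedback ℓ μ w) volume 0 t := by
  -- Almost everywhere on (0, t) the feedback is μ times the shift of w cut off to (0, M): the lower
  -- cut reproduces the zero before 2ℓ, and M exceeds s - 2ℓ for all s < t.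
  set M := t - 2 * ℓ + 1
  have h1 : Integrable ((Ioo 0 M).indicator w) :=
    (integrable_indicator_iff measurableSet_Ioo).2 ((hw M).integrable (by norm_num))
  have h2 : Integrable (fun s => μ * (Ioo 0 M).indicator w (s - 2 * ℓ)) :=
    (h1.comp_sub_right (2 * ℓ)).const_mul μ
  rw [intervalIntegrable_iff_integrableOn_Ioo_of_le ht]
  refine h2.integrableOn.congr_fun_ae ?_
  have hne : ∀ᵐ s : ℝ, s ≠ 2 * ℓ := by rw [ae_iff]; simp
  filter_upwards [ae_restrict_mem measurableSet_Ioo, ae_restrict_of_ae hne] with s hs hs2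
  rw [feedback]
  split_ifs with h
  · rw [indicator_of_notMem fun hm => by linarith [hm.1], mul_zero]
  · have : 2 * ℓ < s := lt_of_le_of_ne (not_lt.1 h) hs2.symm
    have hm : s - 2 * ℓ ∈ Ioo 0 M := ⟨by linarith, by simp only [M]; linarith [hs.2]⟩
    rw [indicator_of_mem hm]

theorem intervalIntegrable_wave_term {Y : ℝ → Energy ℓ} (hY : ContinuousOn Y (Ici 0)) {t : ℝ}
    (ht : 0 ≤ t) (φ : VHalf ℓ) :
    IntervalIntegrable (fun s => inner ℝ (dx ℓ (Y s).fst) (dx ℓ φ)) volume 0 t := by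
  refine ContinuousOn.intervalIntegrable ?_
  rw [uIcc_of_le ht]
  have h : Continuous fun U : Energy ℓ => inner ℝ (dx ℓ U.fst) (dx ℓ φ) :=
    ((dx ℓ).continuous.comp (WithLp.fstL 2 ℝ (VHalf ℓ) (V ℓ)).continuous).inner continuous_const
  exact h.comp_continuousOn (hY.mono Icc_subset_Ici_self)

theorem integral_wave_term (hℓ : 0 < ℓ) {Y : ℝ → Energy ℓ} (hY : ContinuousOn Y (Ici 0)) (μ : ℝ)
    {w : ℝ → ℝ} (hw : ∀ T : ℝ, MemLp w 2 (volume.restrict (Ioo 0 T))) {t : ℝ} (ht : 0 ≤ t)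
    (φ : VHalf ℓ) :
    ∫ s in (0 : ℝ)..t, (-inner ℝ (dx ℓ (Y s).fst) (dx ℓ φ) + feedback ℓ μ w s * dirac hℓ φ) =
      -(∫ s in (0 : ℝ)..t, inner ℝ (dx ℓ (Y s).fst) (dx ℓ φ)) +
        (∫ s in (0 : ℝ)..t, feedback ℓ μ w s) * dirac hℓ φ := by
  have hneg : IntervalIntegrable (fun s => -inner ℝ (dx ℓ (Y s).fst) (dx ℓ φ)) volume 0 t :=
    (intervalIntegrable_wave_term hY ht φ).neg
  rw [intervalIntegral.integral_add hneg ((intervalIntegrable_feedback μ hw ht).mul_const _), intervalIntegral.integral_neg,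
    intervalIntegral.integral_mul_const]

theorem intervalIntegrable_of_continuousOn_Ici {E : Type*} [NormedAddCommGroup E] {Y : ℝ → E}
    (hY : ContinuousOn Y (Ici 0)) {a t : ℝ} (ha : 0 ≤ a) (ht : 0 ≤ t) :
    IntervalIntegrable Y volume a t :=
  (hY.mono fun _ hx => (le_min ha ht).trans hx.1).intervalIntegrable

variable {hℓ : 0 < ℓ} {μ : ℝ} {U₀ U₀' : Energy ℓ} {Y Y' : ℝ → Energy ℓ} {w w' : ℝ → ℝ}

namespace IsSolution

/-- The velocity relation and the variational equation are the two components of this identity, from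
which the variation of constants formula is derived. -/
theorem invWave_eq (h : IsSolution hℓ μ U₀ Y w) {t : ℝ} (ht : 0 ≤ t) :
    invWave hℓ (Y t) = invWave hℓ (Y 0) + (∫ s in (0 : ℝ)..t, Y s) +
      (∫ s in (0 : ℝ)..t, feedback ℓ μ w s) • invDirac hℓ := by
  rw [invWave_eq_iff hℓ (intervalIntegrable_of_continuousOn_Ici h.continuousOn le_rfl ht)]
  refine ⟨?_, fun φ => ?_⟩
  · have hs : ContinuousOn (fun s => (Y s).snd) (Ici 0) :=
      (WithLp.sndL 2 ℝ (VHalf ℓ) (V ℓ)).continuous.comp_continuousOn h.continuousOn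
    rw [intervalIntegral.integral_eq_sub_of_hasDerivAt_of_le ht (f := fun s => incl ℓ (Y s).fst)
      (fun s hs => ((h.velocity s hs.1).continuousWithinAt).mono Icc_subset_Ici_self)
      (fun s hs => (h.velocity s hs.1.le).hasDerivAt (Ici_mem_nhds hs.1))
      (intervalIntegrable_of_continuousOn_Ici hs le_rfl ht)]
    abel
  · rw [h.wave φ t ht, integral_wave_term hℓ h.continuousOn μ h.trace_memLp ht]
    ring

theorem of_invWave_eq (hY : Continuous Y) (h0 : Y 0 = U₀)
    (hw : ∀ T : ℝ, MemLp w 2 (volume.restrict (Ioo 0 T)))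
    (htr : ∀ t ∈ Ici (0 : ℝ),
      dirac hℓ (Y t).fst = dirac hℓ (Y 0).fst + ∫ s in (0 : ℝ)..t, w s)
    (h : ∀ t ∈ Ici (0 : ℝ), invWave hℓ (Y t) = invWave hℓ (Y 0) + (∫ s in (0 : ℝ)..t, Y s) +
      (∫ s in (0 : ℝ)..t, feedback ℓ μ w s) • invDirac hℓ) :
    IsSolution hℓ μ U₀ Y w := by
  have hc := fun t ht => (invWave_eq_iff hℓ (hY.intervalIntegrable 0 t) _).1 (h t ht)
  refine ⟨hY.continuousOn, fun t ht => ?_, hw, htr, fun φ t ht => ?_, h0⟩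
  · have hs : Continuous fun s => (Y s).snd :=
      (WithLp.sndL 2 ℝ (VHalf ℓ) (V ℓ)).continuous.comp hY
    have hd := ((hs.integral_hasStrictDerivAt 0 t).hasDerivAt.const_add
      (incl ℓ (Y 0).fst)).hasDerivWithinAt (s := Ici 0)
    exact hd.congr (fun s hs => (hc s hs).1) (hc t ht).1
  · rw [(hc t ht).2, integral_wave_term hℓ hY.continuousOn μ hw ht]
    ring

theorem sub (h : IsSolution hℓ μ U₀ Y w) (h' : IsSolution hℓ μ U₀' Y' w') :
    IsSolution hℓ μ (U₀ - U₀') (fun t => Y t - Y' t) (fun t => w t - w' t) := by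
  have hw : ∀ {w : ℝ → ℝ}, (∀ T : ℝ, MemLp w 2 (volume.restrict (Ioo 0 T))) → ∀ t ∈ Ici (0 : ℝ),
      IntervalIntegrable w volume 0 t := fun hw t ht =>
    (intervalIntegrable_iff_integrableOn_Ioo_of_le ht).2 ((hw t).integrable (by norm_num))
  have hm : ∀ T : ℝ, MemLp (fun t => w t - w' t) 2 (volume.restrict (Ioo 0 T)) := fun T => (h.trace_memLp T).sub (h'.trace_memLp T)
  refine ⟨h.continuousOn.sub h'.continuousOn, fun t ht => ?_, hm, fun t ht => ?_,
    fun φ t ht => ?_, by rw [h.initial, h'.initial]⟩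
  · exact ((h.velocity t ht).fun_sub (h'.velocity t ht)).congr
      (fun s _ => map_sub (incl ℓ) _ _) (map_sub (incl ℓ) _ _)
  · rw [intervalIntegral.integral_sub (hw h.trace_memLp t ht) (hw h'.trace_memLp t ht)]
    simp only [WithLp.sub_fst, map_sub]
    rw [h.trace_eq t ht, h'.trace_eq t ht]
    ring
  · have hf : ∀ s, feedback ℓ μ (fun t => w t - w' t) s =
        feedback ℓ μ w s - feedback ℓ μ w' s := fun s => by
      simp only [feedback]
      split_ifs <;> ring
    rw [integral_wave_term hℓ (Y := fun t => Y t - Y' t) (h.continuousOn.sub h'.continuousOn) μ hm ht]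
    simp only [hf, WithLp.sub_fst, WithLp.sub_snd, map_sub, inner_sub_left]
    rw [intervalIntegral.integral_sub (intervalIntegrable_wave_term h.continuousOn ht φ)
      (intervalIntegrable_wave_term h'.continuousOn ht φ), intervalIntegral.integral_sub
      (intervalIntegrable_feedback μ h.trace_memLp ht)
      (intervalIntegrable_feedback μ h'.trace_memLp ht), h.wave φ t ht, h'.wave φ t ht,
      integral_wave_term hℓ h.continuousOn μ h.trace_memLp ht,
      integral_wave_term hℓ h'.continuousOn μ h'.trace_memLp ht]
    ring

end IsSolution

/-- Existence of solutions, by the explicit travelling waves. -/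
theorem isSolution_wave (hℓ : 0 < ℓ) (μ : ℝ) (U : Energy ℓ) :
    IsSolution hℓ μ U (wave hℓ (scaledExt ℓ (delayCoeff μ) (invariants U)))
      (waveTrace ℓ (scaledExt ℓ (delayCoeff μ) (invariants U))) := by
  set h := scaledExt ℓ (delayCoeff μ) (invariants U) with hdef
  have hh : IsLocL2 h := isLocL2_invariants hℓ _ U
  refine IsSolution.of_invWave_eq (continuous_wave hℓ hh) (wave_scaledExt_zero hℓ rfl U)
    (fun T => ?_) (fun t _ => ?_) fun t ht => ?_
  -- The slice lemma is reused with time in place of space and T in place of ℓ.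
  · have hs : ∀ c : ℝ, MemLp (fun t => h (t + c)) 2 (volume.restrict (Ioo 0 T)) := fun c => by
      simpa only [one_mul, add_comm c] using hh.memLp_affine (ℓ := T) (Or.inl rfl) c
    exact ((hs ℓ).sub (hs (-ℓ))).const_mul (1 / 2)
  · rw [dirac_wave hℓ hh, dirac_wave hℓ hh]
    simp only [waveTrace]
    rw [intervalIntegral.integral_const_mul, intervalIntegral.integral_sub
        (by simpa only [add_comm] using hh.intervalIntegrable_add ℓ 0 t)
        (by simpa only [sub_eq_neg_add] using hh.intervalIntegrable_add (-ℓ) 0 t),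
      intervalIntegral.integral_comp_add_right (fun s => h s),
      intervalIntegral.integral_comp_sub_right (fun s => h s), hh.integral_eq, hh.integral_eq]
    ring
  · rw [invWave_wave hℓ hh t]
    congr 2
    refine intervalIntegral.integral_congr fun s hs => ?_
    rw [uIcc_of_le ht] at hs
    exact (feedback_delayCoeff hℓ μ _ hs.1).symm

/-- The group generated by the wave operator. -/
theorem exists_waveGroup (hℓ : 0 < ℓ) :
    ∃ S : ℝ → Energy ℓ →L[ℝ] Energy ℓ, IsC0Group S ∧ (∀ t U, ‖S t U‖ = ‖U‖) ∧
      ∀ U, IsOrbit (invWave hℓ) fun t => S t U :=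
  have := completeSpace_VHalf hℓ
  exists_group (inner_invWave_self hℓ) fun U =>
    ⟨_, isOrbit_freeWave hℓ U, wave_scaledExt_zero hℓ (zpow_zero _) U⟩

section Group

variable {S : ℝ → Energy ℓ →L[ℝ] Energy ℓ}

/-- Variation of constants for the delayed system, after application of the inverse of the wave
operator. -/
theorem IsSolution.variation (hS : IsC0Group S) (hn : ∀ t U, ‖S t U‖ = ‖U‖)
    (hR : ∀ U, IsOrbit (invWave hℓ) fun t => S t U) (h : IsSolution hℓ μ U₀ Y w) {a t : ℝ}
    (ha : 0 ≤ a) (hat : a ≤ t) :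
    invWave hℓ (Y t) = S (t - a) (invWave hℓ (Y a)) +
      ∫ s in a..t, feedback ℓ μ w s • S (t - s) (invDirac hℓ) := by
  have := completeSpace_VHalf hℓ
  have hf : ∀ s, 0 ≤ s → IntervalIntegrable (feedback ℓ μ w) volume 0 s := fun s hs =>
    intervalIntegrable_feedback μ h.trace_memLp hs
  refine variation_of_constants (inner_invWave_self hℓ) (invWave_injective hℓ) hS hn hR hat
    (h.continuousOn.mono fun s hs => ha.trans hs.1)
    ((hf a ha).symm.trans (hf t (ha.trans hat))) fun s hs => ?_
  have hs0 := ha.trans hs.1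
  rw [h.invWave_eq hs0, h.invWave_eq ha,
    ← intervalIntegral.integral_add_adjacent_intervals (hf a ha) ((hf a ha).symm.trans (hf s hs0)),
    ← intervalIntegral.integral_add_adjacent_intervals
      (intervalIntegrable_of_continuousOn_Ici h.continuousOn le_rfl ha)
      (intervalIntegrable_of_continuousOn_Ici h.continuousOn ha hs0), add_smul]
  abel

/-- Without control the variation formula reads R Y(t) = R S(t) U₀, and R is injective. This serves
both the first time interval and the induction for uniqueness. -/
theorem IsSolution.eq_group_of_feedback_eq_zero (hS : IsC0Group S) (hn : ∀ t U, ‖S t U‖ = ‖U‖)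
    (hR : ∀ U, IsOrbit (invWave hℓ) fun t => S t U) (h : IsSolution hℓ μ U₀ Y w) {t : ℝ}
    (ht : 0 ≤ t) (hf : ∀ᵐ s, s ∈ Ioo 0 t → feedback ℓ μ w s = 0) : Y t = S t U₀ := by
  have := completeSpace_VHalf hℓ
  refine invWave_injective hℓ ?_
  have h0 : ∫ s in (0 : ℝ)..t, feedback ℓ μ w s • S (t - s) (invDirac hℓ) = 0 := by
    refine intervalIntegral.integral_zero_ae ?_
    have hne : ∀ᵐ s : ℝ, s ≠ t := by rw [ae_iff]; simp
    filter_upwards [hf, hne] with s hs hst hsm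
    rw [uIoc_of_le ht] at hsm
    rw [hs ⟨hsm.1, lt_of_le_of_ne hsm.2 hst⟩, zero_smul]
  rw [h.variation hS hn hR le_rfl ht, h0, add_zero, sub_zero, h.initial,
    group_comm (inner_invWave_self hℓ) hS hR]

end Group

/-- The trace identity controls only the primitive of w; Lebesgue differentiation recovers w almost
everywhere. -/
theorem ae_eq_zero_of_integral_eq_zero {w : ℝ → ℝ} {T : ℝ} (hT : 0 ≤ T)
    (hw : IntervalIntegrable w volume 0 T) (h : ∀ t ∈ Icc 0 T, ∫ s in (0 : ℝ)..t, w s = 0) :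
    ∀ᵐ s, s ∈ Ioo 0 T → w s = 0 := by
  filter_upwards [hw.ae_hasDerivAt_integral] with s hs hsm
  have h1 := hs (by rw [uIcc_of_le hT]; exact Ioo_subset_Icc_self hsm) 0 left_mem_uIcc
  refine h1.unique ((hasDerivAt_const s (0 : ℝ)).congr_of_eventuallyEq ?_)
  filter_upwards [Ioo_mem_nhds hsm.1 hsm.2] with t ht
  exact h t (Ioo_subset_Icc_self ht)

/-- Uniqueness, by steps of length `2ℓ`. -/
theorem IsSolution.eq_zero (h : IsSolution hℓ μ 0 Y w) {t : ℝ} (ht : 0 ≤ t) : Y t = 0 := by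
  obtain ⟨S, hS, hn, hR⟩ := exists_waveGroup hℓ
  have key : ∀ n : ℕ, ∀ t ∈ Icc 0 (n * (2 * ℓ)), Y t = 0 := by
    intro n
    induction n with
    | zero =>
      intro t ht
      have : t = 0 := le_antisymm (by simpa using ht.2) ht.1
      rw [this, h.initial]
    | succ n ih =>
      intro t ht
      have hT : 0 ≤ n * (2 * ℓ) := by positivity
      have hw : ∀ᵐ s, s ∈ Ioo 0 (n * (2 * ℓ)) → w s = 0 := by
        refine ae_eq_zero_of_integral_eq_zero hT
          ((intervalIntegrable_iff_integrableOn_Ioo_of_le hT).2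
            ((h.trace_memLp _).integrable (by norm_num))) fun s hs => ?_
        have := h.trace_eq s hs.1
        rwa [ih s hs, ih 0 (left_mem_Icc.2 hT), left_eq_add] at this
      -- Translation by 2ℓ preserves null sets, so the vanishing of w up to 2nℓ makes the feedback
      -- vanish up to 2(n + 1)ℓ.
      have hw' := (measurePreserving_sub_right volume (2 * ℓ)).quasiMeasurePreserving.ae hw
      have hne : ∀ᵐ s : ℝ, s ≠ 2 * ℓ := by rw [ae_iff]; simp
      rw [h.eq_group_of_feedback_eq_zero hS hn hR ht.1, map_zero]
      filter_upwards [hw', hne] with s hs hs2 hsm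
      rw [feedback]
      split_ifs with hlt
      · rfl
      · have h1 := ht.2
        push_cast at h1
        rw [hs ⟨sub_pos.2 (lt_of_le_of_ne (not_lt.1 hlt) hs2.symm), by linarith [hsm.2]⟩, mul_zero]
  obtain ⟨n, hn⟩ := exists_nat_ge (t / (2 * ℓ))
  exact key n t ⟨ht, (div_le_iff₀ (by linarith)).1 hn⟩

end SwitchingDelayWave

end

/-! ### Assembly of the well-posedness theorem -/

open SwitchingDelayWave
theorem theorem2p1 (ℓ : ℝ) (hℓ : 0 < ℓ) (μ : ℝ) :
    ∃ (S : ℝ → Energy ℓ →L[ℝ] Energy ℓ) (S₁ : ℝ → Extrapolation ℓ →L[ℝ] Extrapolation ℓ),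
      -- the isometry group generated by the wave operator, and its extrapolation
      IsWaveGroup S ∧ (∀ (t : ℝ) (U : Energy ℓ), ‖S t U‖ = ‖U‖) ∧ IsExtrapolatedGroup S S₁ ∧
      -- existence, for all data in the energy space, with the explicit form of the solution
      (∀ U₀ : Energy ℓ, ∃ (Y : ℝ → Energy ℓ) (w : ℝ → ℝ), IsSolution hℓ μ U₀ Y w) ∧
      (∀ (U₀ : Energy ℓ) (Y : ℝ → Energy ℓ) (w : ℝ → ℝ), IsSolution hℓ μ U₀ Y w →
        (∀ t ∈ Set.Icc 0 (2 * ℓ), Y t = S t U₀) ∧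
        (∀ j : ℕ, 1 ≤ j → ∀ t ∈ Set.Icc (2 * j * ℓ) (2 * (j + 1) * ℓ),
          IntervalIntegrable
            (fun s => S₁ (t - s) (WithLp.toLp 2 (0, (μ * w (s - 2 * ℓ)) • dirac hℓ)))
            MeasureTheory.volume (2 * j * ℓ) t ∧
          embed (Y t) = embed (S (t - 2 * j * ℓ) (Y (2 * j * ℓ))) +
            ∫ s in (2 * j * ℓ)..t,
              S₁ (t - s) (WithLp.toLp 2 (0, (μ * w (s - 2 * ℓ)) • dirac hℓ))) ∧
        (∀ j : ℕ, ContinuousOn Y (Set.Icc (2 * j * ℓ) (2 * (j + 1) * ℓ)))) ∧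
      -- uniqueness
      (∀ (U₀ : Energy ℓ) (Y Y' : ℝ → Energy ℓ) (w w' : ℝ → ℝ),
        IsSolution hℓ μ U₀ Y w → IsSolution hℓ μ U₀ Y' w' → Set.EqOn Y Y' (Set.Ici 0)) ∧
      -- continuous dependence on the data
      (∀ T : ℝ, ∃ C : ℝ, ∀ (U₀ U₀' : Energy ℓ) (Y Y' : ℝ → Energy ℓ) (w w' : ℝ → ℝ),
        IsSolution hℓ μ U₀ Y w → IsSolution hℓ μ U₀' Y' w' →
          ∀ t ∈ Set.Icc 0 T, ‖Y t - Y' t‖ ≤ C * ‖U₀ - U₀'‖) := by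
  have := completeSpace_VHalf hℓ
  obtain ⟨S, hS, hn, hR⟩ := exists_waveGroup hℓ
  have hskew := inner_invWave_self hℓ
  have hcomm := group_comm hskew hS hR
  have huniq : ∀ (U₀ : Energy ℓ) (Y Y' : ℝ → Energy ℓ) (w w' : ℝ → ℝ),
      IsSolution hℓ μ U₀ Y w → IsSolution hℓ μ U₀ Y' w' → Set.EqOn Y Y' (Set.Ici 0) := by
    intro U₀ Y Y' w w' h h' t ht
    have hd := h.sub h'
    rw [sub_self] at hd
    exact sub_eq_zero.1 (hd.eq_zero ht)
  refine ⟨S, extGroup hℓ S, ⟨hS, fun U W => ?_⟩, hn, isExtrapolatedGroup_extGroup hℓ hS hcomm,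
    fun U₀ => ⟨_, _, isSolution_wave hℓ μ U₀⟩, fun U₀ Y w h => ⟨fun t ht => ?_,
      fun j hj t ht => ?_, fun j => ?_⟩, huniq, fun T => ?_⟩
  · rw [isWaveOp_iff hℓ, hasDerivAt_group_iff hskew hS hR]
  · refine h.eq_group_of_feedback_eq_zero hS hn hR ht.1 (Filter.Eventually.of_forall fun s hs => ?_)
    exact if_pos (hs.2.trans_le ht.2)
  · have hj1 : (1 : ℝ) ≤ j := by exact_mod_cast hj
    have ha2 : 2 * ℓ ≤ 2 * j * ℓ := by nlinarith
    have ha : 0 ≤ 2 * j * ℓ := by positivity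
    have hfi : IntervalIntegrable (feedback ℓ μ w) MeasureTheory.volume (2 * j * ℓ) t :=
      (intervalIntegrable_feedback μ h.trace_memLp ha).symm.trans
        (intervalIntegrable_feedback μ h.trace_memLp (ha.trans ht.1))
    have hSb : Continuous fun s => S (t - s) (invDirac hℓ) :=
      (hS.continuous _).comp (continuous_const.sub continuous_id)
    have hint : IntervalIntegrable (fun s => feedback ℓ μ w s • S (t - s) (invDirac hℓ))
        MeasureTheory.volume (2 * j * ℓ) t := hfi.smul_continuousOn hSb.continuousOn
    -- As j ≥ 1, every s in the interval is at least 2ℓ and the feedback is active. The singular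
    -- integrand is the image under `waveExt` of an integrable function with values in the energy
    -- space, so its Bochner integral converges.
    have heq : Set.EqOn (fun s => waveExt hℓ (feedback ℓ μ w s • S (t - s) (invDirac hℓ)))
        (fun s => extGroup hℓ S (t - s) (WithLp.toLp 2 (0, (μ * w (s - 2 * ℓ)) • dirac hℓ)))
        (Set.uIcc (2 * j * ℓ) t) := by
      intro s hs
      rw [Set.uIcc_of_le ht.1] at hs
      have hf : feedback ℓ μ w s = μ * w (s - 2 * ℓ) := if_neg (by linarith [hs.1])
      simp only
      rw [← waveExt_invDirac, extGroup_waveExt, map_smul (S _), hf]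
    constructor
    · refine IntervalIntegrable.congr (fun s hs => heq (Set.uIoc_subset_uIcc hs)) ?_
      exact ⟨(waveExt hℓ).toContinuousLinearMap.integrable_comp hint.1,
        (waveExt hℓ).toContinuousLinearMap.integrable_comp hint.2⟩
    -- Applying `waveExt` to the variation formula cancels R and yields the embedded identity.
    · rw [← intervalIntegral.integral_congr heq, ← waveExt_invWave hℓ, ← waveExt_invWave hℓ,
        h.variation hS hn hR ha ht.1, map_add, hcomm]
      congr 1
      exact ((waveExt hℓ).toContinuousLinearMap.intervalIntegral_comp_comm hint).symm
  · exact h.continuousOn.mono fun s hs => le_trans (by positivity) hs.1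
  · obtain ⟨C, hC⟩ := exists_norm_wave_le hℓ (delayCoeff μ) T
    refine ⟨C, fun U₀ U₀' Y Y' w w' h h' t ht => ?_⟩
    -- The difference solves the problem with data U₀ - U₀', so by uniqueness it is the explicit
    -- wave already estimated.
    have e := huniq _ _ _ _ _ (h.sub h') (isSolution_wave hℓ μ (U₀ - U₀')) ht.1
    exact (congrArg norm e).le.trans (hC _ t ht)
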